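/- Let $F$ be a field of characteristic $p>0$. All algebras are finite-dimensional over $F$. A restricted Lie algebra $(L,[p])$ is a Lie algebra $L$ with a map $x\mapsto x^{[p]}$ satisfying $\operatorname{ad}(x)^p=\operatorname{ad}(x^{[p]})$, $(\lambda x)^{[p]}=\lambda^p x^{[p]}$ and $(x+y)^{[p]}=x^{[p]}+y^{[p]}+\sum_{i=1}^{p-1}s_i(x,y)$, where the $s_i(x,y)\in L$ are given by $\operatorname{ad}(x\otimes X+y\otimes 1)^{p-1}(x\otimes 1)=\sum_{i=1}^{p-1} i\,s_i(x,y)\otimes X^{i-1}$ in $L\otimes_F F[X]$. A $[p]$-subalgebra (respectively $[p]$-ideal) is a subalgebra (ideal) closed under $[p]$; $[p]$-subalgebras, and quotients by $[p]$-ideals, are restricted Lie algebras with the induced $p$-operation. A minimal $[p]$-ideal is one that is minimal among the non-zero $[p]$-ideals; a maximal $[p]$-subalgebra is one that is maximal among the proper $[p]$-subalgebras. The $[p]$-Frattini subalgebra $\Psi(L)$ is the intersection of the maximal $[p]$-subalgebras of $L$ (and is $L$ if there are none). A $[p]$-subalgebra $S$ of $L$ is $[p]$-subnormal if there is a chain $S=S_0\subseteq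 S_1\subseteq\dots\subseteq S_n=L$ in which each $S_i$ is a $[p]$-ideal of $S_{i+1}$. A soluble restricted Lie algebra is primitive if it has a minimal $[p]$-ideal that is equal to its own centralizer. An atom is a non-zero abelian restricted Lie algebra whose only $[p]$-subalgebras are $0$ and itself. A $p$-Schunck class is a non-empty class $\mathfrak H$ of soluble restricted Lie algebras over $F$, closed under isomorphism, such that a soluble restricted Lie algebra $L$ belongs to $\mathfrak H$ if and only if every primitive quotient $L/K$ ($K$ a $[p]$-ideal of $L$) belongs to $\mathfrak H$. **Theorem.** Let $\mathfrak H$ be a $p$-Schunck class containing all atoms. Let $(L,[p])$ be a (not necessarily soluble) restricted Lie algebra, let $A$ be a $[p]$-subnormal subalgebra of $L$, and let $B$ be a $[p]$-ideal of $A$ with $B\subseteq\Psi(L)$ and $A/B\in\mathfrak H$. Then $A\in\mathfrak H$. -/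

import Mathlib

universe u v

/-- The coefficients of `ad(X x + y)^n (x)` in `L ⊗ F[X]`: `jacobsonCoeff x y n k` is the
coefficient of `X ^ k`. -/
def jacobsonCoeff {L : Type v} [LieRing L] (x y : L) : ℕ → ℕ → L
  | 0, 0 => x
  | 0, _ + 1 => 0
  | n + 1, 0 => ⁅y, jacobsonCoeff x y n 0⁆
  | n + 1, k + 1 => ⁅x, jacobsonCoeff x y n k⁆ + ⁅y, jacobsonCoeff x y n (k + 1)⁆

/-- The Jacobson polynomial `S(x, y) = ∑_{i=1}^{p-1} s_i(x, y)`, where the `s_i(x, y)` are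
determined by `ad(X x + y)^(p-1) (x) = ∑_{i=1}^{p-1} i s_i(x, y) X^(i-1)`. The summation index
below is `i - 1`. -/
def jacobsonSum (F : Type u) [Field F] (p : ℕ) {L : Type v} [LieRing L] [LieAlgebra F L]
    (x y : L) : L :=
  ∑ i ∈ Finset.range (p - 1), ((i + 1 : ℕ) : F)⁻¹ • jacobsonCoeff x y (p - 1) i

/-- A `p`-operation on a Lie algebra `L` over `F` (where `p` is the characteristic of `F`). -/
structure POperation (F : Type u) [Field F] (p : ℕ) (L : Type v) [LieRing L]
    [LieAlgebra F L] where
  toFun : L → L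
  ad_pow : ∀ x : L, LieAlgebra.ad F L x ^ p = LieAlgebra.ad F L (toFun x)
  map_smul : ∀ (c : F) (x : L), toFun (c • x) = c ^ p • toFun x
  map_add : ∀ x y : L, toFun (x + y) = toFun x + toFun y + jacobsonSum F p x y

theorem jacobsonCoeff_map {F : Type u} [Field F] {L : Type v} {M : Type v} [LieRing L]
    [LieAlgebra F L] [LieRing M] [LieAlgebra F M] (f : L →ₗ⁅F⁆ M) (x y : L) (n k : ℕ) :
    f (jacobsonCoeff x y n k) = jacobsonCoeff (f x) (f y) n k := by
  induction n generalizing k with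
  | zero => cases k <;> simp [jacobsonCoeff]
  | succ n ih => cases k <;> simp [jacobsonCoeff, ih]

theorem jacobsonSum_map {F : Type u} [Field F] {p : ℕ} {L : Type v} {M : Type v} [LieRing L]
    [LieAlgebra F L] [LieRing M] [LieAlgebra F M] (f : L →ₗ⁅F⁆ M) (x y : L) :
    f (jacobsonSum F p x y) = jacobsonSum F p (f x) (f y) := by
  simp [jacobsonSum, jacobsonCoeff_map]

theorem jacobsonCoeff_mem {F : Type u} [Field F] {L : Type v} [LieRing L] [LieAlgebra F L]
    (K : LieIdeal F L) (x : L) {y : L} (hy : y ∈ K) (n : ℕ) :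
    (∀ k, k ≠ n → jacobsonCoeff x y n k ∈ K) ∧ (jacobsonCoeff x y n n ∈ K ∨
      jacobsonCoeff x y n n = x) ∧ (n ≠ 0 → jacobsonCoeff x y n n ∈ K) := by
  induction n with
  | zero =>
    refine ⟨fun k hk => ?_, Or.inr rfl, fun h => absurd rfl h⟩
    cases k with
    | zero => exact absurd rfl hk
    | succ k => simp [jacobsonCoeff]
  | succ n ih =>
    obtain ⟨h1, h2, -⟩ := ih
    have hyz : ∀ z : L, ⁅y, z⁆ ∈ K := fun z => by
      rw [← lie_skew]
      exact K.neg_mem (K.lie_mem hy)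
    have h3 : jacobsonCoeff x y (n + 1) (n + 1) ∈ K := by
      refine K.add_mem ?_ (hyz _)
      rcases h2 with h | h
      · exact K.lie_mem h
      · rw [h, lie_self]
        exact K.zero_mem
    refine ⟨fun k hk => ?_, Or.inl h3, fun _ => h3⟩
    cases k with
    | zero => exact hyz _
    | succ k => exact K.add_mem (K.lie_mem (h1 k (by omega))) (hyz _)

theorem jacobsonSum_mem {F : Type u} [Field F] {p : ℕ} {L : Type v} [LieRing L]
    [LieAlgebra F L] (K : LieIdeal F L) (x : L) {y : L} (hy : y ∈ K) :
    jacobsonSum F p x y ∈ K := by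
  refine sum_mem fun i hi => K.smul_mem _ ?_
  exact (jacobsonCoeff_mem K x hy (p - 1)).1 i (by rw [Finset.mem_range] at hi; omega)

namespace POperation

variable {F : Type u} [Field F] {p : ℕ} {L : Type v} [LieRing L] [LieAlgebra F L]

/-- `U` is a `[p]`-subalgebra: a subalgebra closed under the `p`-operation. -/
def IsPSubalgebra (P : POperation F p L) (U : LieSubalgebra F L) : Prop :=
  ∀ x ∈ U, P.toFun x ∈ U

/-- `K` is a `[p]`-ideal: an ideal closed under the `p`-operation. -/
def IsPIdeal (P : POperation F p L) (K : LieIdeal F L) : Prop :=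
  ∀ x ∈ K, P.toFun x ∈ K

/-- The `p`-operation induced on a `[p]`-subalgebra. -/
def restrict (P : POperation F p L) (U : LieSubalgebra F L) (hU : P.IsPSubalgebra U) :
    POperation F p U where
  toFun x := ⟨P.toFun x, hU x x.2⟩
  ad_pow x := by
    have key : ∀ (n : ℕ) (y : U), (((LieAlgebra.ad F U x ^ n) y : U) : L) =
        (LieAlgebra.ad F L (x : L) ^ n) (y : L) := by
      intro n
      induction n with
      | zero => intro y; simp
      | succ n ih =>
        intro y
        rw [pow_succ, pow_succ, Module.End.mul_apply, Module.End.mul_apply, ih]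
        rfl
    ext y
    rw [key, P.ad_pow]
    rfl
  map_smul c x := Subtype.ext (P.map_smul c x)
  map_add x y := by
    apply Subtype.ext
    have h := jacobsonSum_map (p := p) U.incl x y
    exact (P.map_add (x : L) (y : L)).trans
      (congrArg (fun z => P.toFun (x : L) + P.toFun (y : L) + z) h.symm)

/-- The `p`-operation induced on the quotient by a `[p]`-ideal: `(x + K)^[p] = x^[p] + K`. -/
def quotient (P : POperation F p L) (K : LieIdeal F L) (hK : P.IsPIdeal K) :
    POperation F p (L ⧸ K) where
  toFun := Quotient.lift (fun x : L => LieSubmodule.Quotient.mk' K (P.toFun x)) (by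
    intro a b hab
    have hab' : b - a ∈ K := by
      have h := (Submodule.quotientRel_def (p := K.toSubmodule)).1 hab
      have h' := K.neg_mem h
      rwa [neg_sub] at h'
    have hb : b = a + (b - a) := by abel
    have h1 : P.toFun b - P.toFun a ∈ K := by
      rw [hb, P.map_add]
      have e : P.toFun a + P.toFun (b - a) + jacobsonSum F p a (b - a) - P.toFun a =
          P.toFun (b - a) + jacobsonSum F p a (b - a) := by abel
      rw [e]
      exact K.add_mem (hK _ hab') (jacobsonSum_mem K a hab')
    have h2 := (LieSubmodule.Quotient.mk_eq_zero' (N := K)).2 h1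
    exact (sub_eq_zero.1 h2).symm)
  ad_pow x := by
    obtain ⟨x, rfl⟩ := LieSubmodule.Quotient.surjective_mk' K x
    have key : ∀ (n : ℕ) (y : L),
        (LieAlgebra.ad F (L ⧸ K) (LieSubmodule.Quotient.mk' K x) ^ n)
          (LieSubmodule.Quotient.mk' K y) =
        LieSubmodule.Quotient.mk' K ((LieAlgebra.ad F L x ^ n) y) := by
      intro n
      induction n with
      | zero => intro y; simp
      | succ n ih =>
        intro y
        rw [pow_succ, pow_succ, Module.End.mul_apply, Module.End.mul_apply, ← ih]
        rfl
    refine LinearMap.ext fun y => ?_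
    obtain ⟨y, rfl⟩ := LieSubmodule.Quotient.surjective_mk' K y
    rw [key, P.ad_pow]
    rfl
  map_smul c x := by
    obtain ⟨x, rfl⟩ := LieSubmodule.Quotient.surjective_mk' K x
    exact congrArg (LieSubmodule.Quotient.mk' K) (P.map_smul c x)
  map_add x y := by
    obtain ⟨x, rfl⟩ := LieSubmodule.Quotient.surjective_mk' K x
    obtain ⟨y, rfl⟩ := LieSubmodule.Quotient.surjective_mk' K y
    have h := congrArg (LieSubmodule.Quotient.mk' K) (P.map_add x y)
    let q : L →ₗ⁅F⁆ (L ⧸ K) :=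
      { (LieSubmodule.Quotient.mk' K : L →ₗ[F] L ⧸ K) with map_lie' := fun {_ _} => rfl }
    have hs := jacobsonSum_map (p := p) q x y
    exact h.trans (congrArg (fun z => LieSubmodule.Quotient.mk' K (P.toFun x) +
      LieSubmodule.Quotient.mk' K (P.toFun y) + z) hs)

/-- `A` is a minimal `[p]`-ideal: minimal among the non-zero `[p]`-ideals. -/
def IsMinimalPIdeal (P : POperation F p L) (A : LieIdeal F L) : Prop :=
  Minimal (fun K : LieIdeal F L => P.IsPIdeal K ∧ K ≠ ⊥) A

/-- `M` is a maximal `[p]`-subalgebra: maximal among the proper `[p]`-subalgebras. -/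
def IsMaximalPSubalgebra (P : POperation F p L) (M : LieSubalgebra F L) : Prop :=
  Maximal (fun U : LieSubalgebra F L => P.IsPSubalgebra U ∧ U ≠ ⊤) M

/-- The `[p]`-Frattini subalgebra `Ψ(L)`: the intersection of the maximal `[p]`-subalgebras. -/
def frattini (P : POperation F p L) : LieSubalgebra F L :=
  sInf {M : LieSubalgebra F L | P.IsMaximalPSubalgebra M}

/-- For subalgebras `S`, `T` of `L`: `S` is contained in `T` and is a `[p]`-ideal of `T`. -/
def IsPIdealIn (P : POperation F p L) (S T : LieSubalgebra F L) : Prop :=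
  S ≤ T ∧ (∀ x ∈ T, ∀ y ∈ S, ⁅x, y⁆ ∈ S) ∧ P.IsPSubalgebra S

/-- `S` is a `[p]`-subnormal subalgebra: a `[p]`-subalgebra with a chain
`S = C 0 ⊆ C 1 ⊆ ⋯ ⊆ C n = L` in which each `C i` is a `[p]`-ideal of `C (i + 1)`. -/
structure IsPSubnormal (P : POperation F p L) (S : LieSubalgebra F L) : Prop where
  isPSubalgebra : P.IsPSubalgebra S
  exists_chain : ∃ (n : ℕ) (C : ℕ → LieSubalgebra F L), C 0 = S ∧ C n = ⊤ ∧
    ∀ i < n, P.IsPIdealIn (C i) (C (i + 1))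

/-- `(L, [p])` is primitive: it is soluble and has a minimal `[p]`-ideal `A` whose centralizer
in `L` is `A`. -/
def IsPrimitive (P : POperation F p L) : Prop :=
  LieAlgebra.IsSolvable L ∧ ∃ A : LieIdeal F L, P.IsMinimalPIdeal A ∧
    ∀ x : L, (∀ a ∈ A, ⁅x, a⁆ = 0) ↔ x ∈ A

/-- `(L, [p])` is an atom: it is non-zero and abelian, and has no `[p]`-subalgebras other than
`0` and `L`. -/
def IsAtomic (P : POperation F p L) : Prop :=
  Nontrivial L ∧ IsLieAbelian L ∧ ∀ U : LieSubalgebra F L, P.IsPSubalgebra U → U = ⊥ ∨ U = ⊤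

end POperation

/-- Finite-dimensional restricted Lie algebras `(L, [p])` over `F`. -/
structure RestrictedLieAlg (F : Type u) [Field F] (p : ℕ) where
  carrier : Type v
  [lieRing : LieRing carrier]
  [lieAlgebra : LieAlgebra F carrier]
  [finiteDimensional : FiniteDimensional F carrier]
  op : POperation F p carrier

namespace RestrictedLieAlg

attribute [instance] lieRing lieAlgebra finiteDimensional

variable {F : Type u} [Field F] {p : ℕ}

/-- The restricted Lie algebra `(L, [p])` given by a `p`-operation on `L`. -/
abbrev of {L : Type v} [LieRing L] [LieAlgebra F L] [FiniteDimensional F L]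
    (P : POperation F p L) : RestrictedLieAlg.{u, v} F p :=
  ⟨L, P⟩

/-- The quotient `(L/K, [p])`. -/
abbrev quotient (X : RestrictedLieAlg.{u, v} F p) (K : LieIdeal F X.carrier)
    (hK : X.op.IsPIdeal K) : RestrictedLieAlg.{u, v} F p :=
  of (X.op.quotient K hK)

/-- Isomorphism of restricted Lie algebras. -/
def Iso (X Y : RestrictedLieAlg.{u, v} F p) : Prop :=
  ∃ e : X.carrier ≃ₗ⁅F⁆ Y.carrier, ∀ x, e (X.op.toFun x) = Y.op.toFun (e x)

/-- The class of soluble restricted Lie algebras all of whose primitive quotients are in `𝒳`. -/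
def primClosure (𝒳 : Set (RestrictedLieAlg.{u, v} F p)) : Set (RestrictedLieAlg.{u, v} F p) :=
  {X | LieAlgebra.IsSolvable X.carrier ∧ ∀ (K : LieIdeal F X.carrier) (hK : X.op.IsPIdeal K),
    (X.quotient K hK).op.IsPrimitive → X.quotient K hK ∈ 𝒳}

/-- `p`-Schunck classes: non-empty, isomorphism-closed classes `ℋ` of soluble restricted Lie
algebras that consist of exactly the soluble restricted Lie algebras all of whose primitive
quotients are in `ℋ`. -/
structure IsPSchunckClass (ℋ : Set (RestrictedLieAlg.{u, v} F p)) : Prop where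
  iso_closed : ∀ X Y : RestrictedLieAlg.{u, v} F p, X ∈ ℋ → Iso X Y → Y ∈ ℋ
  nonempty : ℋ.Nonempty
  primClosure_eq : primClosure ℋ = ℋ

end RestrictedLieAlg

/-! Let `Y = A/K` be a primitive quotient of `A`. Atoms lie in `ℋ` by hypothesis; otherwise `Y` has
zero centre and a proper, self-centralizing ideal `S` contained in every non-zero ideal. The ideal
`K` need not contain `B`. Instead, the surjection `f : A → Y` is replaced by another one that kills
`B`, so that `Y` becomes an image of `A/B`. Because `Y` is centreless, every Lie surjection onto it
respects the `p`-operations, so only Lie homomorphisms have to be constructed.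

The replacement goes by induction on `dim L`: find a non-zero `[p]`-ideal `J` of `L` inside `A` and
a surjection `A → Y` killing `J` (`exists_pIdeal_surjective`), then pass to `L/J`. If `ker f`
contains a non-zero ideal of `L`, the largest such ideal serves as `J`. If not, the largest ideal
`E` of `L` inside the preimage of `S` is abelian. Some `d ∈ A` satisfies `[d, L] ⊆ E` while `f d`
does not centralize `S`; then `ad d` is injective on `E` and `L = C_L(d) ⊕ E`. A maximal
`[p]`-subalgebra `M ⊇ C_L(d)` contains `B`, and `J = M ∩ E` is an ideal of `L`, smaller than `E`,
and non-zero because `f(B) ≠ 0`. A non-zero `A`-homomorphism `φ : E → S` killing `J`, combined with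
`f` on `C_A(d)`, is the new surjection.

Subnormality is what yields `d` and `φ`: stability under `A` is carried up the chain to `L`, and
repeated brackets with `A` lead from `L` down into `A`. Solubility of `A` follows since `B` is
nilpotent, by a Fitting argument. -/

/-! ### Subideals, and Engel's theorem on a self-centralizing minimal ideal -/

section LieGeneral

variable {F : Type u} [Field F] {L : Type v} [LieRing L] [LieAlgebra F L]

/-- The largest ideal of `L` contained in the subspace `W`. -/
def idealCore (W : Submodule F L) : LieIdeal F L :=
  sSup {I : LieIdeal F L | I.toSubmodule ≤ W}

theorem le_idealCore {W : Submodule F L} {I : LieIdeal F L} (h : I.toSubmodule ≤ W) :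
    I ≤ idealCore W :=
  le_sSup h

theorem idealCore_le (W : Submodule F L) : (idealCore W).toSubmodule ≤ W := by
  rw [idealCore, LieSubmodule.sSup_toSubmodule]
  apply sSup_le
  rintro _ ⟨I, hI, rfl⟩
  exact hI

/-- `A` is joined to `L` by a chain of `n` subalgebras, each an ideal in the next. -/
structure IsSubidealChain (A : LieSubalgebra F L) (n : ℕ) (C : ℕ → LieSubalgebra F L) : Prop where
  zero : C 0 = A
  last : C n = ⊤
  le_succ : ∀ i < n, C i ≤ C (i + 1)
  lie_mem : ∀ i < n, ∀ x ∈ C (i + 1), ∀ y ∈ C i, ⁅x, y⁆ ∈ C i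

namespace IsSubidealChain

variable {A : LieSubalgebra F L} {n : ℕ} {C : ℕ → LieSubalgebra F L}

theorem le (h : IsSubidealChain A n C) {i : ℕ} (hi : i ≤ n) : A ≤ C i := by
  induction i with
  | zero => exact h.zero.ge
  | succ i ih => exact (ih (by omega)).trans (h.le_succ i (by omega))

theorem lie_mem' (h : IsSubidealChain A n C) {i : ℕ} (hi : i < n) {a x : L} (ha : a ∈ A)
    (hx : x ∈ C (i + 1)) : ⁅a, x⁆ ∈ C i := by
  rw [← lie_skew]
  exact neg_mem (h.lie_mem i hi x hx a (h.le hi.le ha))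

/-- To show that a subspace is stable under `L`, go up the chain from `A`. -/
theorem stable (h : IsSubidealChain A n C) (U : Submodule F L)
    (h0 : ∀ a ∈ A, ∀ u ∈ U, ⁅a, u⁆ ∈ U)
    (hs : ∀ K : LieSubalgebra F L, A ≤ K → (∀ k ∈ K, ∀ u ∈ U, ⁅k, u⁆ ∈ U) →
      ∀ x : L, (∀ a ∈ A, ⁅a, x⁆ ∈ K) → ∀ u ∈ U, ⁅x, u⁆ ∈ U) (x : L) {u : L} (hu : u ∈ U) :
    ⁅x, u⁆ ∈ U := by
  have key : ∀ i ≤ n, ∀ y ∈ C i, ∀ u ∈ U, ⁅y, u⁆ ∈ U := by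
    intro i
    induction i with
    | zero => intro _; rw [h.zero]; exact h0
    | succ i ih =>
      intro hi y hy
      exact hs (C i) (h.le (by omega)) (ih (by omega)) y
        fun a ha => h.lie_mem' (by omega) ha hy
  exact key n le_rfl x (by rw [h.last]; trivial) u hu

/-- Each bracket with `A` moves one step down the chain, so `n` brackets lead from `L` into `A`. -/
theorem lowerCentralSeries_le (h : IsSubidealChain A n C) {i : ℕ} (hi : i ≤ n) :
    ∀ x ∈ LieModule.lowerCentralSeries F A L i, x ∈ C (n - i) := by
  induction i with
  | zero => intro x _; rw [Nat.sub_zero, h.last]; trivial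
  | succ i ih =>
    intro x hx
    rw [LieModule.lowerCentralSeries_succ, ← LieSubmodule.mem_toSubmodule,
      LieSubmodule.lieIdeal_oper_eq_linear_span'] at hx
    have hle : Submodule.span F {m : L | ∃ a ∈ (⊤ : LieIdeal F A),
        ∃ m' ∈ LieModule.lowerCentralSeries F A L i, ⁅a, m'⁆ = m} ≤
        (C (n - (i + 1))).toSubmodule := by
      rw [Submodule.span_le]
      rintro _ ⟨a, -, m, hm, rfl⟩
      refine h.lie_mem' (by omega) a.2 ?_
      have := ih (by omega) m hm
      rwa [show n - (i + 1) + 1 = n - i by omega]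
    exact hle hx

/-- The stable term of the series `L ⊇ [A, L] ⊇ [A, [A, L]] ⊇ ⋯` of a subideal `A` is an ideal. -/
theorem exists_lieIdeal (h : IsSubidealChain A n C) [FiniteDimensional F L] :
    ∃ (R : LieIdeal F L) (k : ℕ), R.toSubmodule ≤ A.toSubmodule ∧
      ∀ x ∈ LieModule.lowerCentralSeries F A L k, x ∈ R := by
  obtain ⟨k, hk⟩ := Filter.eventually_atTop.1
    (LieModule.eventually_iInf_lowerCentralSeries_eq F A L)
  set W := LieModule.lowerCentralSeries F A L with hW
  set R := ⨅ k, W k with hR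
  have hRle : ∀ j, R ≤ W j := iInf_le W
  have hRs : R = ⁅(⊤ : LieIdeal F A), R⁆ := by
    conv_lhs => rw [hk (k + 1) (by omega), hW, LieModule.lowerCentralSeries_succ]
    rw [hk k le_rfl]
  have hst : ∀ (x : L) {u : L}, u ∈ R.toSubmodule → ⁅x, u⁆ ∈ R.toSubmodule := by
    intro x u
    refine h.stable R.toSubmodule (fun a ha u hu => R.lie_mem (x := (⟨a, ha⟩ : A)) hu) ?_ x
    intro K hAK hK x hx
    -- Since `R = [A, R]`, the Leibniz rule gives `[x, [a, m]] = [[x, a], m] + [a, [x, m]]`: the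
    -- first term is in `R` because `[x, a] ∈ K`, and the second gains one step in the series.
    have : ∀ j, ∀ u ∈ R.toSubmodule, ⁅x, u⁆ ∈ W j := by
      intro j
      induction j with
      | zero => intro u _; simp [hW]
      | succ j ih =>
        intro u hu
        rw [hRs, LieSubmodule.lieIdeal_oper_eq_linear_span'] at hu
        induction hu using Submodule.span_induction with
        | mem u hu =>
          obtain ⟨a, -, m, hm, rfl⟩ := hu
          have e : ⁅x, ⁅a, m⁆⁆ = ⁅⁅x, (a : L)⁆, m⁆ + ⁅a, ⁅x, m⁆⁆ := leibniz_lie x (a : L) m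
          rw [e]
          refine add_mem ?_ ?_
          · have h1 : ⁅x, (a : L)⁆ ∈ K := by
              rw [← lie_skew]; exact neg_mem (hx a a.2)
            exact hRle _ (hK _ h1 m hm)
          · rw [hW, LieModule.lowerCentralSeries_succ]
            exact LieSubmodule.lie_mem_lie (LieSubmodule.mem_top a) (ih m hm)
        | zero => simp
        | add a b _ _ ha hb => rw [lie_add]; exact add_mem ha hb
        | smul c a _ ha => rw [lie_smul]; exact (W (j + 1)).smul_mem c ha
    intro u hu
    rw [LieSubmodule.mem_toSubmodule, hR, LieSubmodule.mem_iInf]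
    exact fun j => this j u hu
  refine ⟨{ R.toSubmodule with lie_mem := fun {x u} hu => hst x hu }, k, ?_, ?_⟩
  · intro x hx
    have := h.lowerCentralSeries_le le_rfl x (hRle n hx)
    rwa [Nat.sub_self, h.zero] at this
  · intro x hx
    rw [← hk k le_rfl] at hx
    exact hx

end IsSubidealChain

/-- Engel's theorem for the action of an ideal `N` on an ideal `S` that is minimal among the
ideals of `Y` and is its own centralizer. -/
theorem exists_forall_ad_pow_ne_zero {Y : Type v} [LieRing Y] [LieAlgebra F Y]
    {S N : LieIdeal F Y} [FiniteDimensional F S]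
    (hS : ∀ x : Y, (∀ a ∈ S, ⁅x, a⁆ = 0) ↔ x ∈ S) (hmin : ∀ I : LieIdeal F Y, I ≠ ⊥ → S ≤ I)
    (hS0 : S ≠ ⊥) (hN : ¬ N ≤ S) :
    ∃ z ∈ N, ∀ k : ℕ, ∃ s ∈ S, (LieAlgebra.ad F Y z ^ k) s ≠ 0 := by
  by_contra! hcon
  have hpow : ∀ (z : N) (k : ℕ) (s : S), (((LieModule.toEnd F N S z) ^ k) s : Y) =
      (LieAlgebra.ad F Y (z : Y) ^ k) (s : Y) := by
    intro z k
    induction k with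
    | zero => intro s; simp
    | succ k ih =>
      intro s
      rw [pow_succ, pow_succ, Module.End.mul_apply, Module.End.mul_apply, ih]
      rfl
  have hnil : LieModule.IsNilpotent N S := by
    rw [LieModule.isNilpotent_iff_forall' (R := F)]
    intro z
    obtain ⟨k, hk⟩ := hcon z z.2
    refine ⟨k, LinearMap.ext fun s => Subtype.ext ?_⟩
    rw [hpow, hk s s.2]
    rfl
  have : Nontrivial S := (LieSubmodule.nontrivial_iff_ne_bot F Y Y).2 hS0
  have hnt := LieModule.nontrivial_max_triv_of_isNilpotent F N S
  obtain ⟨⟨s, hs⟩, hs0⟩ := exists_ne (0 : LieModule.maxTrivSubmodule F N S)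
  -- By Engel, `N` kills a non-zero element of `S`. The elements of `S` killed by `N` form an ideal,
  -- so they fill `S`, and `N` centralizes `S`.
  let I : LieIdeal F Y :=
    { carrier := {s | s ∈ S ∧ ∀ z ∈ N, ⁅z, s⁆ = 0}
      add_mem' := fun {a b} ha hb => ⟨add_mem ha.1 hb.1, fun z hz => by
        rw [lie_add, ha.2 z hz, hb.2 z hz, add_zero]⟩
      zero_mem' := ⟨zero_mem _, fun z _ => lie_zero z⟩
      smul_mem' := fun c a ha => ⟨S.smul_mem c ha.1, fun z hz => by
        rw [lie_smul, ha.2 z hz, smul_zero]⟩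
      lie_mem := fun {x a} ha => ⟨S.lie_mem ha.1, fun z hz => by
        rw [leibniz_lie, ha.2 z hz, lie_zero, add_zero]
        exact ha.2 _ (lie_mem_left F Y N z x hz)⟩ }
  have hI : I ≠ ⊥ := by
    intro hI
    have : (s : Y) ∈ I := ⟨s.2, fun z hz => by
      have := (LieModule.mem_maxTrivSubmodule F N S s).1 hs ⟨z, hz⟩
      exact congrArg Subtype.val this⟩
    rw [hI, LieSubmodule.mem_bot] at this
    exact hs0 (Subtype.ext (Subtype.ext this))
  refine hN fun z hz => (hS z).1 fun a ha => (hmin I hI ha).2 z hz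

end LieGeneral

/-! ### Powers of `ad` and the `p`-operation -/

namespace POperation

variable {F : Type u} [Field F] {p : ℕ} {L : Type v} [LieRing L] [LieAlgebra F L]

theorem toFun_lie (P : POperation F p L) (x y : L) :
    ⁅P.toFun x, y⁆ = (LieAlgebra.ad F L x ^ p) y := by
  rw [P.ad_pow, LieAlgebra.ad_apply]

theorem ad_iterate (P : POperation F p L) (k : ℕ) (x : L) :
    LieAlgebra.ad F L (P.toFun^[k] x) = LieAlgebra.ad F L x ^ p ^ k := by
  induction k with
  | zero => simp
  | succ k ih => rw [Function.iterate_succ_apply', ← P.ad_pow, ih, ← pow_mul, pow_succ]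

theorem pow_ad_mem {K : LieIdeal F L} {x : L} (hx : x ∈ K) {m : ℕ} (hm : m ≠ 0) (y : L) :
    (LieAlgebra.ad F L x ^ m) y ∈ K := by
  obtain ⟨m, rfl⟩ := Nat.exists_eq_succ_of_ne_zero hm
  rw [pow_succ', Module.End.mul_apply, LieAlgebra.ad_apply]
  exact lie_mem_left F L K x _ hx

/-- The largest ideal inside a subspace closed under the `p`-operation is a `[p]`-ideal. -/
theorem isPIdeal_idealCore [Fact p.Prime] (P : POperation F p L) {W : Submodule F L}
    (hW : ∀ x ∈ W, P.toFun x ∈ W) : P.IsPIdeal (idealCore W) := by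
  intro x hx
  -- Adjoining `x^[p]` to the core keeps it an ideal, since `ad x^[p] = (ad x)^p` maps `L` into the
  -- core.
  let I : LieIdeal F L :=
    { (idealCore W).toSubmodule ⊔ Submodule.span F {P.toFun x} with
      lie_mem := by
        intro y z hz
        refine Submodule.mem_sup_left ?_
        obtain ⟨u, hu, w, hw, rfl⟩ := Submodule.mem_sup.1 hz
        obtain ⟨c, rfl⟩ := Submodule.mem_span_singleton.1 hw
        rw [lie_add, lie_smul]
        refine add_mem ((idealCore W).lie_mem hu) (Submodule.smul_mem _ c ?_)
        rw [← lie_skew, P.toFun_lie]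
        exact neg_mem (pow_ad_mem hx (Fact.out : p.Prime).ne_zero y) }
  have hI : I ≤ idealCore W := by
    refine le_idealCore (sup_le (idealCore_le W) ?_)
    rw [Submodule.span_singleton_le_iff_mem]
    exact hW x (idealCore_le W hx)
  exact hI (Submodule.mem_sup_right (Submodule.mem_span_singleton_self _))

end POperation

/-! ### Homomorphisms of `A`-modules into `S` -/

section Equivariant

variable {F : Type u} [Field F] {L : Type v} [LieRing L] [LieAlgebra F L] {A : LieSubalgebra F L}
  {Y : Type v} [LieRing Y] [LieAlgebra F Y]

/-- An ideal of `L`, as a module for the subalgebra `A`. -/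
def LieIdeal.restrictAction (I : LieIdeal F L) (A : LieSubalgebra F L) : LieSubmodule F A L :=
  { I.toSubmodule with lie_mem := fun {_ _} h => I.lie_mem h }

/-- The restriction of `g` to `T` is a homomorphism of `A`-modules to `S`, where `A` acts on `S`
through `f`. -/
structure IsEquivariantOn (f : A →ₗ⁅F⁆ Y) (S : LieIdeal F Y) (T : LieSubmodule F A L)
    (g : L →ₗ[F] Y) : Prop where
  mem : ∀ t ∈ T, g t ∈ S
  map_lie : ∀ (a : A), ∀ t ∈ T, g ⁅(a : L), t⁆ = ⁅f a, g t⁆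

/-- `g` on `T` and `0` on `J` agree on the intersection, so they glue to `T + J`. -/
theorem LinearMap.exists_eq_of_eq_zero_on_inf {V W : Type v} [AddCommGroup V] [Module F V]
    [AddCommGroup W] [Module F W] (g : V →ₗ[F] W) {T J : Submodule F V}
    (h : ∀ x ∈ T, x ∈ J → g x = 0) :
    ∃ φ : V →ₗ[F] W, (∀ t ∈ T, φ t = g t) ∧ ∀ j ∈ J, φ j = 0 := by
  let g₁ : V →ₗ.[F] W := ⟨T, g.comp T.subtype⟩
  let g₂ : V →ₗ.[F] W := ⟨J, 0⟩
  have H : ∀ (x : g₁.domain) (y : g₂.domain), (x : V) = y → g₁ x = g₂ y := by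
    intro x y hxy
    exact h x x.2 (hxy ▸ y.2)
  obtain ⟨φ, hφ⟩ := LinearMap.exists_extend (g₁.sup g₂ H).toFun
  have hφ' : ∀ z : (g₁.sup g₂ H).domain, φ z = (g₁.sup g₂ H) z := fun z => LinearMap.congr_fun hφ z
  refine ⟨φ, fun t ht => ?_, fun j hj => ?_⟩
  · have hz : t ∈ (g₁.sup g₂ H).domain := Submodule.mem_sup_left ht
    have := LinearPMap.sup_apply H ⟨t, ht⟩ ⟨0, J.zero_mem⟩ ⟨t, hz⟩ (add_zero t)
    exact (hφ' ⟨t, hz⟩).trans (this.trans (add_zero _))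
  · have hz : j ∈ (g₁.sup g₂ H).domain := Submodule.mem_sup_right hj
    have := LinearPMap.sup_apply H ⟨0, T.zero_mem⟩ ⟨j, hj⟩ ⟨j, hz⟩ (zero_add j)
    refine (hφ' ⟨j, hz⟩).trans (this.trans ?_)
    change g 0 + 0 = 0
    rw [map_zero, add_zero]

/-- Allows `f` and all maps out of submodules to be treated as linear maps on `L`; the values
outside the relevant submodule are irrelevant. -/
theorem exists_linearMap_extending (f : A →ₗ⁅F⁆ Y) : ∃ g : L →ₗ[F] Y, ∀ a : A, g a = f a := by
  obtain ⟨g, hg⟩ := LinearMap.exists_extend (p := A.toSubmodule) (f : A →ₗ[F] Y)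
  exact ⟨g, fun a => LinearMap.congr_fun hg a⟩

variable {n : ℕ} {C : ℕ → LieSubalgebra F L} {f : A →ₗ⁅F⁆ Y} {S : LieIdeal F Y}

/-- A non-zero `A`-submodule of `E` has a non-zero homomorphism to `S`, if `f` maps `E` to `S` and
no non-zero ideal of `L` to `0`. -/
theorem IsSubidealChain.exists_isEquivariantOn [FiniteDimensional F L]
    (hC : IsSubidealChain A n C) {E : LieIdeal F L}
    (hE : ∀ x ∈ E, ∃ h : x ∈ A, f ⟨x, h⟩ ∈ S)
    (hcore : ∀ I : LieIdeal F L, (∀ x ∈ I, ∃ h : x ∈ A, f ⟨x, h⟩ = 0) → I = ⊥)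
    {T : LieSubmodule F A L} (hTE : T ≤ E.restrictAction A) (hT0 : T ≠ ⊥) :
    ∃ g : L →ₗ[F] Y, IsEquivariantOn f S T g ∧ ∃ t ∈ T, g t ≠ 0 := by
  by_contra! hT
  -- A maximal submodule `M` of `E` above `T` without non-zero homomorphisms to `S` turns out to be
  -- an ideal of `L`. Then `f` itself vanishes on it, which forces `M = 0`.
  let 𝒯 : Set (LieSubmodule F A L) := {T' | T ≤ T' ∧ T' ≤ E.restrictAction A ∧
    ∀ g : L →ₗ[F] Y, IsEquivariantOn f S T' g → ∀ t ∈ T', g t = 0}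
  obtain ⟨M, ⟨hTM, hME, hM⟩, hmax⟩ := wellFounded_gt.has_min 𝒯 ⟨T, le_rfl, hTE, hT⟩
  have hst : ∀ (x : L) {u : L}, u ∈ M.toSubmodule → ⁅x, u⁆ ∈ M.toSubmodule := by
    intro x u
    refine hC.stable M.toSubmodule (fun a ha u hu => M.lie_mem (x := (⟨a, ha⟩ : A)) hu) ?_ x
    intro K hAK hK x hx
    have hx' : ∀ a : A, ⁅x, (a : L)⁆ ∈ K := fun a => by
      rw [← lie_skew]; exact neg_mem (hx a a.2)
    let M' : LieSubmodule F A L :=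
      { M.toSubmodule ⊔ M.toSubmodule.map (LieAlgebra.ad F L x : L →ₗ[F] L) with
        lie_mem := by
          intro a z hz
          obtain ⟨u, hu, w, hw, rfl⟩ := Submodule.mem_sup.1 hz
          obtain ⟨t, ht, rfl⟩ := hw
          rw [lie_add]
          refine add_mem (Submodule.mem_sup_left (M.lie_mem hu)) ?_
          have e : ⁅a, (LieAlgebra.ad F L x) t⁆ = ⁅x, ⁅(a : L), t⁆⁆ - ⁅⁅x, (a : L)⁆, t⁆ := by
            rw [leibniz_lie x (a : L) t, add_sub_cancel_left]; rfl
          rw [e]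
          exact sub_mem (Submodule.mem_sup_right ⟨_, M.lie_mem (x := a) ht, rfl⟩)
            (Submodule.mem_sup_left (hK _ (hx' a) t ht)) }
    have hMM' : M ≤ M' := fun t ht => Submodule.mem_sup_left ht
    have hM'E : M' ≤ E.restrictAction A := by
      intro z hz
      obtain ⟨u, hu, w, ⟨t, ht, rfl⟩, rfl⟩ := Submodule.mem_sup.1 hz
      exact add_mem (hME hu) (E.lie_mem (hME ht))
    have hM' : M' ∈ 𝒯 := by
      refine ⟨hTM.trans hMM', hM'E, fun g hg => ?_⟩
      have h1 : ∀ t ∈ M, g t = 0 :=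
        hM g ⟨fun t ht => hg.mem t (hMM' ht), fun a t ht => hg.map_lie a t (hMM' ht)⟩
      -- As `g` vanishes on `M` and `[[x, a], t] ∈ M`, the map `t ↦ g [x, t]` is again equivariant
      -- on `M`, hence zero.
      have h2 : ∀ t ∈ M, (g.comp (LieAlgebra.ad F L x : L →ₗ[F] L)) t = 0 := by
        refine hM _ ⟨fun t ht => hg.mem _ (Submodule.mem_sup_right ⟨t, ht, rfl⟩),
          fun a t ht => ?_⟩
        change g ⁅x, ⁅(a : L), t⁆⁆ = ⁅f a, g ⁅x, t⁆⁆
        rw [leibniz_lie x (a : L) t, map_add, h1 _ (hK _ (hx' a) t ht), zero_add]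
        exact hg.map_lie a _ (Submodule.mem_sup_right ⟨t, ht, rfl⟩)
      intro z hz
      obtain ⟨u, hu, w, ⟨t, ht, rfl⟩, rfl⟩ := Submodule.mem_sup.1 hz
      rw [map_add, h1 u hu, zero_add]
      exact h2 t ht
    have hle : M' ≤ M := by
      by_contra hlt
      exact hmax M' hM' (lt_of_le_not_ge hMM' hlt)
    intro u hu
    exact hle (Submodule.mem_sup_right ⟨u, hu, rfl⟩)
  obtain ⟨g, hg⟩ := exists_linearMap_extending f
  have hgM : ∀ t ∈ M, g t = 0 := by
    refine hM g ⟨fun t ht => ?_, fun a t ht => ?_⟩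
    · obtain ⟨h, h'⟩ := hE t (hME ht)
      rwa [← hg] at h'
    · obtain ⟨h, h'⟩ := hE t (hME ht)
      rw [show g t = f ⟨t, h⟩ from hg ⟨t, h⟩, ← LieHom.map_lie, ← hg]
      rfl
  have hbot := hcore { M.toSubmodule with lie_mem := fun {x u} hu => hst x hu } (by
    intro x hx
    obtain ⟨h, -⟩ := hE x (hME hx)
    exact ⟨h, by rw [← hg]; exact hgM x hx⟩)
  refine hT0 (le_bot_iff.1 fun t ht => ?_)
  have : t ∈ (⊥ : LieIdeal F L) := hbot ▸ (hTM ht : t ∈ M.toSubmodule)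
  exact this

/-- If `f` maps `E` to `S` and no non-zero ideal of `L` to `0`, then every non-zero quotient of
`E` by an ideal of `L` has a non-zero homomorphism of `A`-modules to `S`. -/
theorem IsSubidealChain.exists_isEquivariantOn_eq_zero [FiniteDimensional F L]
    (hC : IsSubidealChain A n C) (hf : Function.Surjective f)
    (hmin : ∀ I : LieIdeal F Y, I ≠ ⊥ → S ≤ I) {E J : LieIdeal F L}
    (hE : ∀ x ∈ E, ∃ h : x ∈ A, f ⟨x, h⟩ ∈ S)
    (hcore : ∀ I : LieIdeal F L, (∀ x ∈ I, ∃ h : x ∈ A, f ⟨x, h⟩ = 0) → I = ⊥)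
    (hJE : J < E) :
    ∃ φ : L →ₗ[F] Y, IsEquivariantOn f S (E.restrictAction A) φ ∧ (∀ j ∈ J, φ j = 0) ∧
      ∃ e ∈ E, φ e ≠ 0 := by
  set E' := E.restrictAction A with hE'
  set J' := J.restrictAction A with hJ'
  have hJE' : J' ≤ E' := fun x hx => hJE.le hx
  -- `T` is a minimal supplement to `J` in `E`; minimality prevents a proper submodule of `T` from
  -- supplementing `J`.
  obtain ⟨T, hT, hTmin⟩ :=
    (LieSubmodule.wellFoundedLT_of_isArtinian F A L).wf.has_min {T : LieSubmodule F A L | T ⊔ J' = E'}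
    ⟨E', sup_eq_left.2 hJE'⟩
  change T ⊔ J' = E' at hT
  have hTE : T ≤ E' := hT ▸ le_sup_left
  have hT0 : T ≠ ⊥ := by
    rintro rfl
    rw [bot_sup_eq] at hT
    exact hJE.not_ge fun x hx => by
      have : x ∈ E' := hx
      rw [← hT] at this
      exact this
  obtain ⟨g, hg, t₀, ht₀, hgt₀⟩ := hC.exists_isEquivariantOn (S := S) hE hcore hTE hT0
  let N : LieSubmodule F A L :=
    { T.toSubmodule ⊓ LinearMap.ker g with
      lie_mem := fun {a t} ht => ⟨T.lie_mem ht.1, by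
        have : g t = 0 := ht.2
        change g ⁅(a : L), t⁆ = 0
        rw [hg.map_lie a t ht.1, this, lie_zero]⟩ }
  have hNT : N ≤ T := fun t ht => ht.1
  have hNlt : N < T := lt_of_le_not_ge hNT fun h => hgt₀ (h ht₀).2
  have hN : N ⊔ J' ≠ E' := fun h => hTmin N h hNlt
  -- `g(T ∩ J)` is an ideal of `Y`. If non-zero, it contains `S ⊇ g(T)`, so `T = (T ∩ ker g) + (T ∩
  -- J)` and `T ∩ ker g` would already supplement `J`.
  have hzero : ∀ t ∈ T.toSubmodule, t ∈ J'.toSubmodule → g t = 0 := by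
    let I : LieIdeal F Y :=
      { (T.toSubmodule ⊓ J'.toSubmodule).map g with
        lie_mem := by
          rintro y _ ⟨t, ht, rfl⟩
          obtain ⟨a, rfl⟩ := hf y
          exact ⟨⁅(a : L), t⁆, ⟨T.lie_mem (x := a) ht.1, J'.lie_mem (x := a) ht.2⟩,
            hg.map_lie a t ht.1⟩ }
    have hI : I = ⊥ := by
      by_contra hI
      have hSI := hmin I hI
      refine hN (le_antisymm (sup_le (hNT.trans hTE) hJE') ?_)
      rw [← hT]
      refine sup_le (fun t ht => ?_) le_sup_right
      obtain ⟨t', ht', he⟩ := hSI (hg.mem t ht)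
      have : t = (t - t') + t' := by abel
      rw [this]
      refine add_mem ((le_sup_left : N ≤ N ⊔ J') ⟨sub_mem ht ht'.1, ?_⟩)
        ((le_sup_right : J' ≤ N ⊔ J') ht'.2)
      change g (t - t') = 0
      rw [map_sub, he, sub_self]
    intro t ht hj
    have : g t ∈ I := ⟨t, ⟨ht, hj⟩, rfl⟩
    rwa [hI] at this
  obtain ⟨φ, hφT, hφJ⟩ := LinearMap.exists_eq_of_eq_zero_on_inf g hzero
  refine ⟨φ, ?_, hφJ, t₀, hTE ht₀, by rwa [hφT t₀ ht₀]⟩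
  have hdec : ∀ e ∈ E', ∃ t ∈ T, ∃ j ∈ J', t + j = e := by
    intro e he
    rw [← hT, LieSubmodule.mem_sup] at he
    exact he
  refine ⟨fun e he => ?_, fun a e he => ?_⟩
  · obtain ⟨t, ht, j, hj, rfl⟩ := hdec e he
    rw [map_add, hφT t ht, hφJ j hj, add_zero]
    exact hg.mem t ht
  · obtain ⟨t, ht, j, hj, rfl⟩ := hdec e he
    have hT' : φ ⁅(a : L), t⁆ = g ⁅(a : L), t⁆ := hφT _ (T.lie_mem (x := a) ht)
    have hJ'' : φ ⁅(a : L), j⁆ = 0 := hφJ _ (J.lie_mem hj)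
    rw [map_add, hφT t ht, hφJ j hj, add_zero, lie_add, map_add, hT', hJ'', add_zero]
    exact hg.map_lie a t ht

end Equivariant

/-! ### Ideals of `L` and of `Y`; an element acting nilpotently modulo `E` but not on `S` -/

section Pullback

variable {F : Type u} [Field F] {L : Type v} [LieRing L] [LieAlgebra F L] {A : LieSubalgebra F L}
  {Y : Type v} [LieRing Y] [LieAlgebra F Y]

/-- The preimage of `S` under `f : A → Y`, as a subspace of `L`. -/
def preimageSubmodule (f : A →ₗ⁅F⁆ Y) (S : LieIdeal F Y) : Submodule F L :=
  (S.toSubmodule.comap (f : A →ₗ[F] Y)).map A.toSubmodule.subtype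

theorem mem_preimageSubmodule {f : A →ₗ⁅F⁆ Y} {S : LieIdeal F Y} {x : L} :
    x ∈ preimageSubmodule f S ↔ ∃ h : x ∈ A, f ⟨x, h⟩ ∈ S := by
  constructor
  · rintro ⟨⟨a, ha⟩, h, rfl⟩
    exact ⟨ha, h⟩
  · rintro ⟨h, h'⟩
    exact ⟨⟨x, h⟩, h', rfl⟩

/-- The image of an ideal `I` of `L` under a surjection `f : A → Y`. -/
def imageIdeal {f : A →ₗ⁅F⁆ Y} (hf : Function.Surjective f) (I : LieIdeal F L) : LieIdeal F Y :=
  { (I.toSubmodule.comap A.toSubmodule.subtype).map (f : A →ₗ[F] Y) with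
    lie_mem := by
      rintro y _ ⟨a, ha, rfl⟩
      obtain ⟨b, rfl⟩ := hf y
      exact ⟨⁅b, a⁆, I.lie_mem (x := (b : L)) ha, f.map_lie b a⟩ }

theorem mem_imageIdeal {f : A →ₗ⁅F⁆ Y} {hf : Function.Surjective f} {I : LieIdeal F L} {y : Y} :
    y ∈ imageIdeal hf I ↔ ∃ a : A, (a : L) ∈ I ∧ f a = y :=
  Iff.rfl

theorem LieHom.map_ad_pow (f : A →ₗ⁅F⁆ Y) (a b : A) (k : ℕ) :
    ∃ h : (LieAlgebra.ad F L (a : L) ^ k) (b : L) ∈ A,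
      f ⟨_, h⟩ = (LieAlgebra.ad F Y (f a) ^ k) (f b) := by
  induction k with
  | zero => exact ⟨b.2, rfl⟩
  | succ k ih =>
    obtain ⟨h, h'⟩ := ih
    rw [pow_succ', pow_succ', Module.End.mul_apply, Module.End.mul_apply, ← h']
    exact ⟨A.lie_mem a.2 h, f.map_lie a ⟨_, h⟩⟩

/-- If a soluble ideal `G` is not contained in `E`, then some derived ideal `D` of `G` is not
contained in `E` while `[D, D]` is. -/
theorem exists_derived_not_le {G E : LieIdeal F L} [hG : LieAlgebra.IsSolvable G] (hGE : ¬ G ≤ E) :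
    ∃ D : LieIdeal F L, D ≤ G ∧ ¬ D ≤ E ∧ ∀ x ∈ D, ∀ y ∈ D, ⁅x, y⁆ ∈ E := by
  obtain ⟨k, hk⟩ := LieAlgebra.IsSolvable.solvable F G
  rw [LieIdeal.derivedSeries_eq_bot_iff] at hk
  have hex : ∃ k, LieAlgebra.derivedSeriesOfIdeal F L k G ≤ E := ⟨k, hk ▸ bot_le⟩
  classical
  obtain ⟨j, hj⟩ : ∃ j, Nat.find hex = j + 1 := by
    refine Nat.exists_eq_succ_of_ne_zero fun h0 => hGE ?_
    have := Nat.find_spec hex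
    rwa [h0] at this
  refine ⟨LieAlgebra.derivedSeriesOfIdeal F L j G, LieAlgebra.derivedSeriesOfIdeal_le_self G j,
    Nat.find_min hex (by omega), fun x hx y hy => ?_⟩
  have := Nat.find_spec hex
  rw [hj, LieAlgebra.derivedSeriesOfIdeal_succ] at this
  exact this (LieSubmodule.lie_mem_lie hx hy)

variable {n : ℕ} {C : ℕ → LieSubalgebra F L} {S : LieIdeal F Y}

/-- A suitable iterated `p`-th power of this `y` is the element `d` that splits `L`. Compare the
largest ideal `G` of `L` inside `A` with `E`. If `G ≤ E`, the stable term of `L ⊇ [A, L] ⊇ ⋯` lies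
in `E`, and any `y` with `f y` not nilpotent on `S` will do. Otherwise `y` is taken in a derived
ideal of `G`. -/
theorem IsSubidealChain.exists_ad_pow_mem [FiniteDimensional F L] [FiniteDimensional F S]
    [LieAlgebra.IsSolvable A]
    (hC : IsSubidealChain A n C) {f : A →ₗ⁅F⁆ Y} (hf : Function.Surjective f)
    (hS : ∀ x : Y, (∀ a ∈ S, ⁅x, a⁆ = 0) ↔ x ∈ S) (hmin : ∀ I : LieIdeal F Y, I ≠ ⊥ → S ≤ I)
    (hS0 : S ≠ ⊥) (hS1 : S ≠ ⊤) :
    ∃ (y : A) (m : ℕ), (∀ x : L, (LieAlgebra.ad F L (y : L) ^ m) x ∈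
      idealCore (preimageSubmodule f S)) ∧
      ∀ k : ℕ, ∃ s ∈ S, (LieAlgebra.ad F Y (f y) ^ k) s ≠ 0 := by
  set E := idealCore (preimageSubmodule f S) with hE
  set G := idealCore A.toSubmodule with hG
  have hGA : ∀ x ∈ G, x ∈ A := fun x hx => idealCore_le _ hx
  by_cases hGE : G ≤ E
  · obtain ⟨R, k, hRA, hR⟩ := hC.exists_lieIdeal
    obtain ⟨z, -, hz⟩ := exists_forall_ad_pow_ne_zero (N := ⊤) hS hmin hS0
      (fun h => hS1 (top_le_iff.1 h))
    obtain ⟨y, rfl⟩ := hf z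
    refine ⟨y, k, fun x => hGE (le_idealCore hRA (hR _ ?_)), hz⟩
    have := LieModule.iterate_toEnd_mem_lowerCentralSeries F A L y x k
    rwa [← Module.End.coe_pow] at this
  · have hsol : LieAlgebra.IsSolvable G := by
      let i : G →ₗ⁅F⁆ A :=
        { toFun := fun x => ⟨x, hGA x x.2⟩
          map_add' := fun _ _ => rfl
          map_smul' := fun _ _ => rfl
          map_lie' := rfl }
      exact Function.Injective.lieAlgebra_isSolvable (f := i)
        fun a b hab => Subtype.ext (congrArg (fun z : A => (z : L)) hab)
    obtain ⟨D, hDG, hDE, hD⟩ := exists_derived_not_le hGE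
    have hN : ¬ imageIdeal hf D ≤ S := by
      intro hle
      refine hDE (le_idealCore fun x hx => mem_preimageSubmodule.2 ⟨hGA x (hDG hx), hle ?_⟩)
      exact mem_imageIdeal.2 ⟨⟨x, hGA x (hDG hx)⟩, hx, rfl⟩
    obtain ⟨z, hz, hz'⟩ := exists_forall_ad_pow_ne_zero hS hmin hS0 hN
    obtain ⟨y, hy, rfl⟩ := mem_imageIdeal.1 hz
    -- `[y, x] ∈ D` as `D` is an ideal, and `[D, D] ⊆ E`.
    refine ⟨y, 2, fun x => ?_, hz'⟩
    rw [pow_two, Module.End.mul_apply, LieAlgebra.ad_apply, LieAlgebra.ad_apply]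
    exact hD _ hy _ (lie_mem_left F L D _ _ hy)

end Pullback

/-! ### Splitting `L` over `E` and altering the surjection -/

section KeyStep

variable {F : Type u} [Field F] {p : ℕ} {L : Type v} [LieRing L] [LieAlgebra F L]
  {Y : Type v} [LieRing Y] [LieAlgebra F Y]

/-- Projection along the centralizer of `d` onto an ideal on which `ad d` is injective. -/
theorem exists_projection [FiniteDimensional F L] {E : LieIdeal F L} {d : L}
    (hd : ∀ x, ⁅d, x⁆ ∈ E) (hinj : ∀ e ∈ E, ⁅d, e⁆ = 0 → e = 0) :
    ∃ π : L →ₗ[F] L, (∀ x, π x ∈ E) ∧ ∀ x, ⁅d, π x⁆ = ⁅d, x⁆ := by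
  let D : L →ₗ[F] E := (LieAlgebra.ad F L d : L →ₗ[F] L).codRestrict E.toSubmodule hd
  have hD : ∀ x, (D x : L) = ⁅d, x⁆ := fun x => rfl
  let δ : E →ₗ[F] E := D.comp E.toSubmodule.subtype
  have hδ : Function.Injective δ := by
    rw [← LinearMap.ker_eq_bot, LinearMap.ker_eq_bot']
    intro e he
    exact Subtype.ext (hinj e e.2 (congrArg Subtype.val he))
  let ε := LinearEquiv.ofInjectiveEndo δ hδ
  refine ⟨E.toSubmodule.subtype.comp ((ε.symm : E →ₗ[F] E).comp D), fun x => (ε.symm (D x)).2,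
    fun x => ?_⟩
  have : ε (ε.symm (D x)) = D x := ε.apply_symm_apply _
  exact congrArg Subtype.val this

theorem exists_maximal_pSubalgebra [FiniteDimensional F L] (P : POperation F p L)
    {M : LieSubalgebra F L} (hM : P.IsPSubalgebra M) (hM1 : M ≠ ⊤) :
    ∃ M' : LieSubalgebra F L, P.IsMaximalPSubalgebra M' ∧ M ≤ M' := by
  obtain ⟨M', ⟨h1, h2, h3⟩, hmax⟩ := wellFounded_gt.has_min
    {M' : LieSubalgebra F L | M ≤ M' ∧ P.IsPSubalgebra M' ∧ M' ≠ ⊤} ⟨M, le_rfl, hM, hM1⟩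
  refine ⟨M', ⟨⟨h2, h3⟩, fun U hU hle => ?_⟩, h1⟩
  by_contra hnot
  exact hmax U ⟨h1.trans hle, hU⟩ (lt_of_le_not_ge hle hnot)

variable [Fact p.Prime] {A : LieSubalgebra F L} {n : ℕ} {C : ℕ → LieSubalgebra F L}
  {S : LieIdeal F Y}

/-- The centralizer of `d`. -/
def elementCentralizer (d : L) : LieSubalgebra F L :=
  { LinearMap.ker (LieAlgebra.ad F L d : L →ₗ[F] L) with
    lie_mem' := by
      intro x y hx hy
      have hx' : ⁅d, x⁆ = 0 := hx
      have hy' : ⁅d, y⁆ = 0 := hy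
      change ⁅d, ⁅x, y⁆⁆ = 0
      rw [leibniz_lie, hx', hy', zero_lie, lie_zero, add_zero] }

theorem mem_elementCentralizer {d x : L} :
    x ∈ elementCentralizer (F := F) d ↔ ⁅d, x⁆ = 0 :=
  Iff.rfl

theorem isPSubalgebra_elementCentralizer (P : POperation F p L) (d : L) :
    P.IsPSubalgebra (elementCentralizer d) := by
  intro x hx
  rw [mem_elementCentralizer] at hx ⊢
  obtain ⟨q, hq⟩ := Nat.exists_eq_succ_of_ne_zero (Fact.out : p.Prime).ne_zero
  rw [← lie_skew, P.toFun_lie, hq, pow_succ, Module.End.mul_apply, LieAlgebra.ad_apply,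
    ← lie_skew, hx, neg_zero, map_zero, neg_zero]

/-- If `L = C_L(d) ⊕ E` with `E` an abelian ideal, a surjection `f : A → Y` can be altered on `E`. -/
theorem exists_altered_surjective {f : A →ₗ⁅F⁆ Y} (hf : Function.Surjective f)
    (hSab : ∀ s ∈ S, ∀ t ∈ S, ⁅s, t⁆ = 0) (hmin : ∀ I : LieIdeal F Y, I ≠ ⊥ → S ≤ I)
    {E : LieIdeal F L} (hE : ∀ x ∈ E, ∃ h : x ∈ A, f ⟨x, h⟩ ∈ S)
    (hEab : ∀ x ∈ E, ∀ y ∈ E, ⁅x, y⁆ = 0) {d : L}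
    (hinj : ∀ e ∈ E, ⁅d, e⁆ = 0 → e = 0) {π : L →ₗ[F] L} (hπE : ∀ x, π x ∈ E)
    (hπd : ∀ x, ⁅d, π x⁆ = ⁅d, x⁆) {φ : L →ₗ[F] Y}
    (hφ : IsEquivariantOn f S (E.restrictAction A) φ) (hφ0 : ∃ e ∈ E, φ e ≠ 0) :
    ∃ ψ : A →ₗ⁅F⁆ Y, Function.Surjective ψ ∧ ∀ a : A, (a : L) ∈ E → ψ a = φ a := by
  obtain ⟨g, hg⟩ := exists_linearMap_extending f
  have hπu : ∀ z ∈ E, ∀ w, ⁅d, z⁆ = ⁅d, w⁆ → π w = z := by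
    intro z hz w h
    refine sub_eq_zero.1 (hinj _ (sub_mem (hπE w) hz) ?_)
    rw [lie_sub, hπd, h, sub_self]
  have hπid : ∀ e ∈ E, π e = e := fun e he => hπu e he e rfl
  have hEA : ∀ x ∈ E, x ∈ A := fun x hx => (hE x hx).1
  have hfE : ∀ a : A, (a : L) ∈ E → f a ∈ S := fun a ha => (hE a ha).2
  let e : A → A := fun a => ⟨π a, hEA _ (hπE a)⟩
  have hφe : ∀ a b : A, (b : L) ∈ E → φ (⁅a, b⁆ : A) = ⁅f a, φ b⁆ := fun a b hb =>
    hφ.map_lie a b hb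
  have hφS : ∀ a : A, φ (e a) ∈ S := fun a => hφ.mem _ (hπE a)
  -- This is `f` on the centralizer part `a - π a` and `φ` on the `E`-part `π a`.
  let ψ₀ : A →ₗ[F] Y := (g.comp (LinearMap.id - π) + φ.comp π).comp A.toSubmodule.subtype
  have hψ₀ : ∀ a : A, ψ₀ a = f (a - e a) + φ (e a) := by
    intro a
    change g ((a : L) - π a) + φ (π a) = _
    rw [← hg]
    rfl
  have hcent : ∀ a : A, ⁅d, ((a - e a : A) : L)⁆ = 0 := by
    intro a
    change ⁅d, (a : L) - π a⁆ = 0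
    rw [lie_sub, hπd, sub_self]
  -- Brackets of two elements centralizing `d` again centralize `d`, and `E` is abelian, so only the
  -- mixed terms contribute to the `E`-part.
  have hπlie : ∀ a b : A, e ⁅a, b⁆ = ⁅a - e a, e b⁆ - ⁅b - e b, e a⁆ := by
    intro a b
    apply Subtype.ext
    refine hπu _ (sub_mem (E.lie_mem (hπE b)) (E.lie_mem (hπE a))) _ ?_
    have h0 : ⁅((e a : A) : L), ((e b : A) : L)⁆ = 0 := hEab _ (hπE a) _ (hπE b)
    have hab : ((⁅a, b⁆ : A) : L) = ⁅((a - e a : A) : L), ((b - e b : A) : L)⁆ +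
        ((⁅a - e a, e b⁆ - ⁅b - e b, e a⁆ : A) : L) := by
      have h1 : ((a : A) : L) = ((a - e a : A) : L) + (e a : A) := by simp
      have h2 : ((b : A) : L) = ((b - e b : A) : L) + (e b : A) := by simp
      change ⁅(a : L), (b : L)⁆ = ⁅((a - e a : A) : L), ((b - e b : A) : L)⁆ +
        (⁅((a - e a : A) : L), ((e b : A) : L)⁆ - ⁅((b - e b : A) : L), ((e a : A) : L)⁆)
      conv_lhs => rw [h1, h2]
      rw [lie_add, add_lie, add_lie, h0, add_zero,
        ← lie_skew ((e a : A) : L) ((b - e b : A) : L)]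
      abel
    rw [hab, lie_add, leibniz_lie d ((a - e a : A) : L), hcent a, hcent b, zero_lie, lie_zero,
      zero_add, zero_add]
    rfl
  let ψ : A →ₗ⁅F⁆ Y :=
    { ψ₀ with
      map_lie' := by
        intro a b
        change ψ₀ ⁅a, b⁆ = ⁅ψ₀ a, ψ₀ b⁆
        have hm : ⁅a, b⁆ - e ⁅a, b⁆ = ⁅a - e a, b - e b⁆ := by
          have h0 : ⁅e a, e b⁆ = 0 := Subtype.ext (hEab _ (hπE a) _ (hπE b))
          rw [hπlie, lie_sub, sub_lie, sub_lie, sub_lie, h0, ← lie_skew b (e a),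
            ← lie_skew (e b) (e a), h0]
          abel
        rw [hψ₀, hψ₀, hψ₀, hm, hπlie]
        have h1 : φ ((⁅a - e a, e b⁆ - ⁅b - e b, e a⁆ : A) : L) =
            ⁅f (a - e a), φ (e b)⁆ - ⁅f (b - e b), φ (e a)⁆ := by
          rw [← hφe _ _ (hπE b), ← hφe _ _ (hπE a), ← map_sub]
          rfl
        rw [h1, lie_add, add_lie, add_lie, hSab _ (hφS a) _ (hφS b), add_zero, LieHom.map_lie,
          ← lie_skew (φ (e a)) (f (b - e b))]
        abel }
  have hψ : ∀ a : A, ψ a = f (a - e a) + φ (e a) := hψ₀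
  have hψE : ∀ a : A, (a : L) ∈ E → ψ a = φ a := by
    intro a ha
    have : e a = a := Subtype.ext (hπid a ha)
    rw [hψ, this, sub_self, map_zero, zero_add]
  refine ⟨ψ, fun y => ?_, hψE⟩
  -- `φ(E)` is a non-zero ideal of `Y`, so it contains `S ⊇ f(E)` and makes up for what `f`
  -- contributed on `E`.
  let I : LieIdeal F Y :=
    { E.toSubmodule.map φ with
      lie_mem := by
        rintro y _ ⟨t, ht, rfl⟩
        obtain ⟨a, rfl⟩ := hf y
        exact ⟨⁅(a : L), t⁆, E.lie_mem ht, hφ.map_lie a t ht⟩ }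
  have hI : I ≠ ⊥ := by
    obtain ⟨t, ht, h0⟩ := hφ0
    intro hI
    have : φ t ∈ I := ⟨t, ht, rfl⟩
    rw [hI] at this
    exact h0 this
  obtain ⟨a, rfl⟩ := hf y
  obtain ⟨t, ht, he⟩ := hmin I hI (hfE (e a) (hπE a))
  have ht' : ψ ⟨t, hEA t ht⟩ = f (e a) := (hψE ⟨t, hEA t ht⟩ ht).trans he
  refine ⟨a - e a + ⟨t, hEA t ht⟩, ?_⟩
  have hz : e (a - e a) = 0 := Subtype.ext (hπu 0 (zero_mem _) _ (by rw [hcent, lie_zero]))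
  rw [map_add, ht', hψ, hz, sub_zero, ZeroMemClass.coe_zero, map_zero, add_zero, ← map_add,
    sub_add_cancel]

/-- A surjection from `A` to `Y` can be altered so as to vanish on some non-zero `[p]`-ideal of
`L` inside `A`. -/
theorem exists_pIdeal_surjective [FiniteDimensional F L] [FiniteDimensional F S]
    [LieAlgebra.IsSolvable A] (P : POperation F p L) (hA : P.IsPSubalgebra A)
    (hC : IsSubidealChain A n C)
    (hS : ∀ x : Y, (∀ a ∈ S, ⁅x, a⁆ = 0) ↔ x ∈ S) (hmin : ∀ I : LieIdeal F Y, I ≠ ⊥ → S ≤ I)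
    (hS0 : S ≠ ⊥) (hS1 : S ≠ ⊤) (B : LieIdeal F A)
    (hBΨ : ∀ b : A, b ∈ B → (b : L) ∈ P.frattini)
    {f : A →ₗ⁅F⁆ Y} (hf : Function.Surjective f) (hB : ∃ b ∈ B, f b ≠ 0) :
    ∃ J : LieIdeal F L, P.IsPIdeal J ∧ J ≠ ⊥ ∧ J.toSubmodule ≤ A.toSubmodule ∧
      ∃ ψ : A →ₗ⁅F⁆ Y, Function.Surjective ψ ∧ ∀ a : A, (a : L) ∈ J → ψ a = 0 := by
  have hSab : ∀ s ∈ S, ∀ t ∈ S, ⁅s, t⁆ = 0 := fun s hs => (hS s).2 hs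
  have hfP : ∀ (x b : A), ⁅f ⟨P.toFun x, hA x x.2⟩, f b⁆ = (LieAlgebra.ad F Y (f x) ^ p) (f b) := by
    intro x b
    obtain ⟨h, h'⟩ := f.map_ad_pow x b p
    rw [← h', ← LieHom.map_lie]
    exact congrArg f (Subtype.ext (P.toFun_lie _ _))
  by_cases hcore : idealCore (preimageSubmodule f ⊥) = ⊥
  swap
  · refine ⟨_, P.isPIdeal_idealCore ?_, hcore, fun x hx => ?_, f, hf, fun a ha => ?_⟩
    · intro x hx
      obtain ⟨h, h'⟩ := mem_preimageSubmodule.1 hx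
      have h0 : f ⟨x, h⟩ = 0 := h'
      refine mem_preimageSubmodule.2 ⟨hA x h, ?_⟩
      -- `f(x^[p])` is central. A non-zero centre of `Y` would contain `S`, and then `Y` would
      -- centralize `S`, forcing `S = Y`.
      have hz : ∀ y : Y, ⁅f ⟨P.toFun x, hA x h⟩, y⁆ = 0 := by
        intro y
        obtain ⟨b, rfl⟩ := hf y
        rw [hfP ⟨x, h⟩ b, h0, map_zero, zero_pow (Fact.out : p.Prime).ne_zero]
        rfl
      by_contra hne
      let I : LieIdeal F Y := LieAlgebra.center F Y
      have hI : I ≠ ⊥ := by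
        intro hI
        refine hne ?_
        rw [← hI, LieModule.mem_maxTrivSubmodule]
        intro y
        rw [← lie_skew, hz, neg_zero]
      refine hS1 (top_le_iff.1 fun y _ => (hS y).1 fun a ha => ?_)
      exact (LieModule.mem_maxTrivSubmodule F Y Y a).1 (hmin I hI ha) y
    · exact (mem_preimageSubmodule.1 (idealCore_le _ hx)).1
    · exact (mem_preimageSubmodule.1 (idealCore_le _ ha)).2
  have hcore' : ∀ I : LieIdeal F L, (∀ x ∈ I, ∃ h : x ∈ A, f ⟨x, h⟩ = 0) → I = ⊥ := by
    intro I hI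
    rw [← le_bot_iff, ← hcore]
    exact le_idealCore fun x hx => mem_preimageSubmodule.2 (hI x hx)
  obtain ⟨y, m, hym, hyS⟩ := hC.exists_ad_pow_mem hf hS hmin hS0 hS1
  set E := idealCore (preimageSubmodule f S) with hEdef
  have hE : ∀ x ∈ E, ∃ h : x ∈ A, f ⟨x, h⟩ ∈ S := fun x hx =>
    mem_preimageSubmodule.1 (idealCore_le _ hx)
  have hEP : P.IsPIdeal E := by
    refine P.isPIdeal_idealCore fun x hx => ?_
    obtain ⟨h, h'⟩ := mem_preimageSubmodule.1 hx
    refine mem_preimageSubmodule.2 ⟨hA x h, (hS _).1 fun s hs => ?_⟩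
    obtain ⟨b, rfl⟩ := hf s
    obtain ⟨q, hq⟩ := Nat.exists_eq_succ_of_ne_zero (Fact.out : p.Prime).ne_zero
    rw [hfP ⟨x, h⟩ b, hq, pow_succ, Module.End.mul_apply, LieAlgebra.ad_apply, hSab _ h' _ hs,
      map_zero]
  have hEab : ∀ x ∈ E, ∀ y ∈ E, ⁅x, y⁆ = 0 := by
    have hbot : ⁅E, E⁆ = ⊥ := by
      refine hcore' _ fun x hx => ?_
      have hle : (⁅E, E⁆ : LieIdeal F L).toSubmodule ≤ preimageSubmodule f ⊥ := by
        rw [LieSubmodule.lieIdeal_oper_eq_linear_span', Submodule.span_le]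
        rintro _ ⟨a, ha, b, hb, rfl⟩
        obtain ⟨ha1, ha2⟩ := hE a ha
        obtain ⟨hb1, hb2⟩ := hE b hb
        refine mem_preimageSubmodule.2 ⟨A.lie_mem ha1 hb1, ?_⟩
        exact (f.map_lie ⟨a, ha1⟩ ⟨b, hb1⟩).trans (hSab _ ha2 _ hb2)
      exact mem_preimageSubmodule.1 (hle hx)
    intro x hx y hy
    have : ⁅x, y⁆ ∈ (⁅E, E⁆ : LieIdeal F L) := LieSubmodule.lie_mem_lie hx hy
    rwa [hbot] at this
  -- Take `d` to be the `m`-fold iterated `p`-th power of `y`: `ad d = (ad y)^(p^m)` maps `L` into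
  -- `E` because `p^m ≥ m`.
  obtain ⟨d, hdE, s₀, hs₀, hds₀⟩ : ∃ d : A, (∀ x, ⁅(d : L), x⁆ ∈ E) ∧ ∃ s ∈ S, ⁅f d, s⁆ ≠ 0 := by
    have hmem : ∀ k, P.toFun^[k] (y : L) ∈ A := by
      intro k
      induction k with
      | zero => exact y.2
      | succ k ih => rw [Function.iterate_succ_apply']; exact hA _ ih
    have hpm : m ≤ p ^ m := (Nat.lt_pow_self (Fact.out : p.Prime).one_lt).le
    refine ⟨⟨_, hmem m⟩, fun x => ?_, ?_⟩
    · have : ⁅P.toFun^[m] (y : L), x⁆ = (LieAlgebra.ad F L (y : L) ^ p ^ m) x := by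
        rw [← P.ad_iterate, LieAlgebra.ad_apply]
      obtain ⟨q, hq⟩ := Nat.exists_eq_add_of_le hpm
      change ⁅P.toFun^[m] (y : L), x⁆ ∈ E
      rw [this, hq, pow_add, Module.End.mul_apply]
      exact hym _
    · obtain ⟨s, hs, hs'⟩ := hyS (p ^ m)
      refine ⟨s, hs, fun h0 => hs' ?_⟩
      obtain ⟨b, rfl⟩ := hf s
      obtain ⟨h, h'⟩ := f.map_ad_pow y b (p ^ m)
      rw [← h', ← h0, ← LieHom.map_lie]
      refine congrArg f (Subtype.ext ?_)
      change (LieAlgebra.ad F L (y : L) ^ p ^ m) (b : L) = ⁅P.toFun^[m] (y : L), (b : L)⁆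
      rw [← P.ad_iterate, LieAlgebra.ad_apply]
  have hSne : ∀ N : LieIdeal F Y, N ≠ ⊥ → ¬ ∀ z ∈ N, ⁅f d, z⁆ = 0 := fun N hN h =>
    hds₀ (h s₀ (hmin N hN hs₀))
  -- `E ∩ C_L(d)` is an ideal of `L`, as `[d, L] ⊆ E` and `E` is abelian. Its image is an ideal of
  -- `Y` centralized by `f d`, hence zero.
  have hinj : ∀ e ∈ E, ⁅(d : L), e⁆ = 0 → e = 0 := by
    let N : LieIdeal F L :=
      { E.toSubmodule ⊓ LinearMap.ker (LieAlgebra.ad F L (d : L) : L →ₗ[F] L) with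
        lie_mem := by
          rintro x e ⟨he, hde⟩
          refine ⟨E.lie_mem he, ?_⟩
          have hde' : ⁅(d : L), e⁆ = 0 := hde
          change ⁅(d : L), ⁅x, e⁆⁆ = 0
          rw [leibniz_lie, hde', lie_zero, add_zero, hEab _ (hdE x) _ he] }
    have hN : N = ⊥ := by
      by_contra hN
      have himg : imageIdeal hf N ≠ ⊥ := by
        intro h
        refine hN (hcore' N fun x hx => ?_)
        obtain ⟨hxA, -⟩ := hE x hx.1
        have : f ⟨x, hxA⟩ ∈ imageIdeal hf N := mem_imageIdeal.2 ⟨⟨x, hxA⟩, hx, rfl⟩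
        rw [h] at this
        exact ⟨hxA, this⟩
      refine hSne _ himg fun z hz => ?_
      obtain ⟨a, ha, rfl⟩ := mem_imageIdeal.1 hz
      have : ⁅d, a⁆ = 0 := Subtype.ext ha.2
      rw [← LieHom.map_lie, this, map_zero]
    intro e he hde
    have : e ∈ N := ⟨he, hde⟩
    rwa [hN] at this
  obtain ⟨π, hπE, hπd⟩ := exists_projection hdE hinj
  have hM1 : elementCentralizer (F := F) (d : L) ≠ ⊤ := by
    intro h
    obtain ⟨b, rfl⟩ := hf s₀
    have : (b : L) ∈ elementCentralizer (F := F) (d : L) := h ▸ LieSubalgebra.mem_top _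
    have : ⁅d, b⁆ = 0 := Subtype.ext this
    exact hds₀ (by rw [← LieHom.map_lie, this, map_zero])
  obtain ⟨M, hM, hdM⟩ := exists_maximal_pSubalgebra P (isPSubalgebra_elementCentralizer P (d : L))
    hM1
  have hMπ : ∀ x, x - π x ∈ M := fun x => hdM (mem_elementCentralizer.2 (by
    rw [lie_sub, hπd, sub_self]))
  -- `M ∩ E` is stable under `M` and under the abelian ideal `E`, and `L = M + E`.
  let J : LieIdeal F L :=
    { M.toSubmodule ⊓ E.toSubmodule with
      lie_mem := by
        rintro x j ⟨hj, hjE⟩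
        refine ⟨?_, E.lie_mem hjE⟩
        have : ⁅x, j⁆ = ⁅x - π x, j⁆ := by rw [sub_lie, hEab _ (hπE x) _ hjE, sub_zero]
        change ⁅x, j⁆ ∈ M
        rw [this]
        exact M.lie_mem (hMπ x) hj }
  have hJ0 : J ≠ ⊥ := by
    intro hJ
    have himg : B.map f ≠ ⊥ := by
      obtain ⟨b, hb, hb0⟩ := hB
      intro h
      have := LieIdeal.mem_map (f := f) hb
      rw [h] at this
      exact hb0 this
    refine hSne _ himg fun z hz => ?_
    obtain ⟨⟨b, hb⟩, rfl⟩ := LieIdeal.mem_map_of_surjective hf hz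
    have hbM : (b : L) ∈ M := sInf_le (a := M) hM (hBΨ b hb)
    -- `b` and `b - π b` both lie in `M`. If `J = 0`, then `d` centralizes `B`, and `f d` the
    -- non-zero ideal `f(B)`.
    have hπb : π b ∈ J := by
      refine ⟨?_, hπE _⟩
      have := M.sub_mem hbM (hMπ b)
      rwa [sub_sub_cancel] at this
    rw [hJ] at hπb
    have hπb' : π b = 0 := hπb
    have : ⁅d, b⁆ = 0 := Subtype.ext (by
      change ⁅(d : L), (b : L)⁆ = 0
      rw [← hπd, hπb', lie_zero])
    change ⁅f d, f b⁆ = 0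
    rw [← LieHom.map_lie, this, map_zero]
  have hJE : J < E := by
    refine lt_of_le_not_ge (fun x hx => hx.2) fun h => hM.prop.2 (top_le_iff.1 fun x _ => ?_)
    rw [← sub_add_cancel x (π x)]
    exact add_mem (hMπ x) (h (hπE x)).1
  obtain ⟨φ, hφ, hφJ, hφ0⟩ := hC.exists_isEquivariantOn_eq_zero hf hmin hE hcore' hJE
  obtain ⟨ψ, hψ, hψE⟩ := exists_altered_surjective hf hSab hmin hE hEab hinj hπE hπd hφ hφ0
  exact ⟨J, fun x hx => ⟨hM.prop.1 x hx.1, hEP x hx.2⟩, hJ0, fun x hx => (hE x hx.2).1, ψ, hψ,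
    fun a ha => (hψE a ha.2).trans (hφJ a ha)⟩

end KeyStep

/-! ### Passage to quotients and the induction on dimension -/

section Quotients

variable {F : Type u} [Field F] {p : ℕ} {L : Type v} [LieRing L] [LieAlgebra F L]

/-- The quotient map `L → L/K` as a homomorphism of Lie algebras. -/
def lieQuotientMk (K : LieIdeal F L) : L →ₗ⁅F⁆ L ⧸ K :=
  { (LieSubmodule.Quotient.mk' K : L →ₗ[F] L ⧸ K) with map_lie' := fun {_ _} => rfl }

theorem lieQuotientMk_surjective (K : LieIdeal F L) : Function.Surjective (lieQuotientMk K) :=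
  LieSubmodule.Quotient.surjective_mk' K

theorem lieQuotientMk_eq_zero {K : LieIdeal F L} {x : L} : lieQuotientMk K x = 0 ↔ x ∈ K :=
  LieSubmodule.Quotient.mk_eq_zero K

theorem LieHom.exists_factor {L₁ L₂ L₃ : Type v} [LieRing L₁] [LieAlgebra F L₁] [LieRing L₂]
    [LieAlgebra F L₂] [LieRing L₃] [LieAlgebra F L₃] {q : L₁ →ₗ⁅F⁆ L₂}
    (hq : Function.Surjective q) (f : L₁ →ₗ⁅F⁆ L₃) (h : ∀ x, q x = 0 → f x = 0) :
    ∃ g : L₂ →ₗ⁅F⁆ L₃, ∀ x, g (q x) = f x := by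
  have heq : ∀ x y, q x = q y → f x = f y := fun x y hxy => by
    rw [← sub_eq_zero, ← map_sub]
    exact h _ (by rw [map_sub, hxy, sub_self])
  let σ := Function.surjInv hq
  have hσ : ∀ y, q (σ y) = y := Function.surjInv_eq hq
  refine ⟨{ toFun := fun y => f (σ y)
            map_add' := fun x y => ?_
            map_smul' := fun c x => ?_
            map_lie' := fun {x y} => ?_ }, fun x => heq _ _ (hσ _)⟩
  · rw [← map_add]
    exact heq _ _ (by rw [map_add, hσ, hσ, hσ])
  · rw [RingHom.id_apply, ← map_smul]
    exact heq _ _ (by rw [map_smul, hσ, hσ])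
  · rw [← LieHom.map_lie]
    exact heq _ _ (by rw [LieHom.map_lie, hσ, hσ, hσ])

/-- Maximal `[p]`-subalgebras of `L/K` pull back to maximal `[p]`-subalgebras of `L`. -/
theorem POperation.map_mem_frattini_quotient (P : POperation F p L) {K : LieIdeal F L}
    (hK : P.IsPIdeal K) {x : L} (hx : x ∈ P.frattini) :
    lieQuotientMk K x ∈ (P.quotient K hK).frattini := by
  have hle : P.frattini ≤ (P.quotient K hK).frattini.comap (lieQuotientMk K) := by
    suffices ∀ M : LieSubalgebra F (L ⧸ K), (P.quotient K hK).IsMaximalPSubalgebra M →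
        P.IsMaximalPSubalgebra (M.comap (lieQuotientMk K)) by
      intro x hx
      rw [LieSubalgebra.mem_comap, POperation.frattini, ← SetLike.mem_coe,
        LieSubalgebra.coe_sInf, Set.mem_iInter₂]
      exact fun M hM => sInf_le (a := M.comap (lieQuotientMk K)) (this M hM) hx
    intro M hM
    refine ⟨⟨fun x hx => hM.prop.1 _ hx, fun h => hM.prop.2 (top_le_iff.1 fun y _ => ?_)⟩,
      fun U hU hle => ?_⟩
    · obtain ⟨x, rfl⟩ := lieQuotientMk_surjective K y
      have : x ∈ M.comap (lieQuotientMk K) := h ▸ LieSubalgebra.mem_top x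
      exact this
    · have hKU : ∀ k ∈ K, k ∈ U := fun k hk => hle (by
        rw [LieSubalgebra.mem_comap, lieQuotientMk_eq_zero.2 hk]
        exact M.zero_mem)
      have hUU : ∀ x, lieQuotientMk K x ∈ U.map (lieQuotientMk K) → x ∈ U := by
        intro x hx
        obtain ⟨u, hu, he⟩ := (LieSubalgebra.mem_map _ _ _).1 hx
        have : x - u ∈ K := by rw [← lieQuotientMk_eq_zero, map_sub, he, sub_self]
        rw [← sub_add_cancel x u]
        exact add_mem (hKU _ this) hu
      have hmap : U.map (lieQuotientMk K) ≤ M := by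
        refine hM.le_of_ge ⟨?_, fun h => hU.2 (top_le_iff.1 fun x _ => hUU x ?_)⟩ ?_
        · intro y hy
          obtain ⟨u, hu, rfl⟩ := (LieSubalgebra.mem_map _ _ _).1 hy
          exact (LieSubalgebra.mem_map _ _ _).2 ⟨_, hU.1 u hu, rfl⟩
        · rw [h]
          exact LieSubalgebra.mem_top _
        · intro y hy
          obtain ⟨x, rfl⟩ := lieQuotientMk_surjective K y
          exact (LieSubalgebra.mem_map _ _ _).2 ⟨x, hle hy, rfl⟩
      exact fun x hx => hmap ((LieSubalgebra.mem_map _ _ _).2 ⟨x, hx, rfl⟩)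
  exact hle hx

/-- If there is a surjection `A → Y`, then there is one that vanishes on `B ⊆ Ψ(L)`. -/
theorem exists_surjective_eq_zero [Fact p.Prime] {Y : Type v} [LieRing Y] [LieAlgebra F Y]
    {S : LieIdeal F Y} [FiniteDimensional F S]
    (hS : ∀ x : Y, (∀ a ∈ S, ⁅x, a⁆ = 0) ↔ x ∈ S) (hmin : ∀ I : LieIdeal F Y, I ≠ ⊥ → S ≤ I)
    (hS0 : S ≠ ⊥) (hS1 : S ≠ ⊤) (m : ℕ) :
    ∀ {L : Type v} [LieRing L] [LieAlgebra F L] [FiniteDimensional F L] (P : POperation F p L)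
      {A : LieSubalgebra F L} {n : ℕ} {C : ℕ → LieSubalgebra F L} [LieAlgebra.IsSolvable A],
      Module.finrank F L = m → P.IsPSubalgebra A → IsSubidealChain A n C → ∀ (B : LieIdeal F A),
      (∀ b : A, b ∈ B → (b : L) ∈ P.frattini) → ∀ f : A →ₗ⁅F⁆ Y, Function.Surjective f →
      ∃ f' : A →ₗ⁅F⁆ Y, Function.Surjective f' ∧ ∀ b ∈ B, f' b = 0 := by
  induction m using Nat.strong_induction_on with
  | _ m ih =>
  intro L _ _ _ P A n C _ hm hA hC B hBΨ f hf
  by_cases hB : ∃ b ∈ B, f b ≠ 0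
  swap
  · push Not at hB
    exact ⟨f, hf, hB⟩
  obtain ⟨J, hJ, hJ0, hJA, ψ, hψ, hψJ⟩ :=
    exists_pIdeal_surjective P hA hC hS hmin hS0 hS1 B hBΨ hf hB
  let A' : LieSubalgebra F (L ⧸ J) := A.map (lieQuotientMk J)
  have hmemA' : ∀ x ∈ A, lieQuotientMk J x ∈ A' := fun x hx =>
    (LieSubalgebra.mem_map _ _ _).2 ⟨x, hx, rfl⟩
  let q : A →ₗ⁅F⁆ A' :=
    { toFun := fun a => ⟨lieQuotientMk J a, hmemA' a a.2⟩
      map_add' := fun _ _ => rfl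
      map_smul' := fun _ _ => rfl
      map_lie' := rfl }
  have hq : Function.Surjective q := by
    rintro ⟨y, hy⟩
    obtain ⟨x, hx, rfl⟩ := (LieSubalgebra.mem_map _ _ _).1 hy
    exact ⟨⟨x, hx⟩, rfl⟩
  have hq0 : ∀ a, q a = 0 → ψ a = 0 := fun a ha =>
    hψJ a (lieQuotientMk_eq_zero.1 (congrArg Subtype.val ha))
  obtain ⟨ψ', hψ'⟩ := LieHom.exists_factor hq ψ hq0
  have hψ's : Function.Surjective ψ' := fun y => by
    obtain ⟨a, rfl⟩ := hψ y
    exact ⟨q a, hψ' a⟩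
  have : LieAlgebra.IsSolvable A' := Function.Surjective.lieAlgebra_isSolvable hq
  have hA' : (P.quotient J hJ).IsPSubalgebra A' := by
    intro y hy
    obtain ⟨x, hx, rfl⟩ := (LieSubalgebra.mem_map _ _ _).1 hy
    exact hmemA' _ (hA x hx)
  have hC' : IsSubidealChain A' n fun i => (C i).map (lieQuotientMk J) := by
    refine ⟨by rw [hC.zero], ?_, fun i hi y hy => ?_, fun i hi x hx y hy => ?_⟩
    · refine top_le_iff.1 fun y _ => ?_
      obtain ⟨x, rfl⟩ := lieQuotientMk_surjective J y
      exact (LieSubalgebra.mem_map _ _ _).2 ⟨x, hC.last ▸ LieSubalgebra.mem_top x, rfl⟩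
    · obtain ⟨x, hx, rfl⟩ := (LieSubalgebra.mem_map _ _ _).1 hy
      exact (LieSubalgebra.mem_map _ _ _).2 ⟨x, hC.le_succ i hi hx, rfl⟩
    · obtain ⟨x, hx', rfl⟩ := (LieSubalgebra.mem_map _ _ _).1 hx
      obtain ⟨y, hy', rfl⟩ := (LieSubalgebra.mem_map _ _ _).1 hy
      exact (LieSubalgebra.mem_map _ _ _).2 ⟨⁅x, y⁆, hC.lie_mem i hi x hx' y hy',
        LieHom.map_lie _ _ _⟩
  have hlt : Module.finrank F (L ⧸ J) < m := by
    have h1 := Submodule.finrank_quotient_add_finrank J.toSubmodule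
    have : J.toSubmodule ≠ ⊥ := fun h => hJ0 (LieSubmodule.toSubmodule_injective h)
    have h2 := Submodule.one_le_finrank_iff.2 this
    change Module.finrank F (L ⧸ J.toSubmodule) < m
    omega
  obtain ⟨g, hg, hgB⟩ := ih _ hlt (P.quotient J hJ) rfl hA' hC' (B.map q) (by
    intro b hb
    obtain ⟨b, rfl⟩ := LieIdeal.mem_map_of_surjective hq hb
    exact P.map_mem_frattini_quotient hJ (hBΨ b b.2)) ψ' hψ's
  exact ⟨g.comp q, hg.comp hq, fun b hb => hgB _ (LieIdeal.mem_map hb)⟩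

end Quotients

/-! ### Nilpotency of subideals inside `Ψ(L)` -/

section Solvable

variable {F : Type u} [Field F] {p : ℕ} {L : Type v} [LieRing L] [LieAlgebra F L]

theorem LieAlgebra.isSolvable_of_quotient (I : LieIdeal F L) [hI : LieAlgebra.IsSolvable I]
    [hQ : LieAlgebra.IsSolvable (L ⧸ I)] : LieAlgebra.IsSolvable L := by
  obtain ⟨l, hl⟩ := LieAlgebra.IsSolvable.solvable F I
  obtain ⟨k, hk⟩ := LieAlgebra.IsSolvable.solvable F (L ⧸ I)
  rw [LieIdeal.derivedSeries_eq_bot_iff] at hl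
  have hle : LieAlgebra.derivedSeries F L k ≤ I := by
    intro x hx
    have h := LieIdeal.mem_map (f := lieQuotientMk I) hx
    rw [LieIdeal.derivedSeries_map_eq k (lieQuotientMk_surjective I), hk] at h
    exact lieQuotientMk_eq_zero.1 h
  refine LieAlgebra.IsSolvable.mk (R := F) (k := l + k) ?_
  rw [LieAlgebra.derivedSeries_def, LieAlgebra.derivedSeriesOfIdeal_add, ← le_bot_iff, ← hl]
  exact LieAlgebra.derivedSeriesOfIdeal_mono hle l

/-- An Engel subalgebra is its own normalizer, and `ad y^[p] = (ad y)^p` preserves it when `y` lies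
in it. -/
theorem POperation.isPSubalgebra_engel (P : POperation F p L) (b : L) :
    P.IsPSubalgebra (LieSubalgebra.engel F b) := by
  intro y hy
  rw [← LieSubalgebra.normalizer_engel, LieSubalgebra.mem_normalizer_iff]
  intro z hz
  rw [P.toFun_lie]
  have : ∀ k : ℕ, (LieAlgebra.ad F L y ^ k) z ∈ LieSubalgebra.engel F b := by
    intro k
    induction k with
    | zero => exact hz
    | succ k ih =>
      rw [pow_succ', Module.End.mul_apply, LieAlgebra.ad_apply]
      exact LieSubalgebra.lie_mem _ hy ih
  exact this p

/-- A subideal of `L` inside the `[p]`-Frattini subalgebra is nilpotent. -/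
theorem IsSubidealChain.isNilpotent_of_le_frattini [FiniteDimensional F L] {A : LieSubalgebra F L}
    {n : ℕ} {C : ℕ → LieSubalgebra F L} (hC : IsSubidealChain A n C) (P : POperation F p L)
    (B : LieIdeal F A) (hBΨ : ∀ b : A, b ∈ B → (b : L) ∈ P.frattini) :
    LieRing.IsNilpotent B := by
  rw [LieAlgebra.isNilpotent_iff_forall (R := F)]
  intro b
  set D := LieAlgebra.ad F L ((b : A) : L) with hD
  have hA : ∀ x, (D ^ n) x ∈ A := by
    intro x
    have h1 := LieModule.iterate_toEnd_mem_lowerCentralSeries F A L (b : A) x n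
    rw [← Module.End.coe_pow] at h1
    have h2 := hC.lowerCentralSeries_le le_rfl _ h1
    rwa [Nat.sub_self, hC.zero] at h2
  -- `n` brackets with `b` lead into `A`, and one more into its ideal `B`.
  have hB : ∀ x, ∀ k, n + 1 ≤ k → ∃ c ∈ B, (c : L) = (D ^ k) x := by
    intro x k hk
    obtain ⟨j, rfl⟩ := Nat.exists_eq_add_of_le hk
    refine ⟨⁅(b : A), (⟨_, hA ((D ^ j) x)⟩ : A)⁆, lie_mem_left F A B _ _ b.2, ?_⟩
    rw [pow_add, pow_succ']
    rfl
  -- By Fitting, `L` is the Engel subalgebra of `b` plus the image of a high power of `ad b`. That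
  -- image lies in `B ⊆ Ψ(L)`, so no maximal `[p]`-subalgebra can contain the Engel subalgebra.
  have htop : LieSubalgebra.engel F ((b : A) : L) = ⊤ := by
    by_contra hne
    obtain ⟨M, hM, hle⟩ := exists_maximal_pSubalgebra P (P.isPSubalgebra_engel _) hne
    refine hM.prop.2 (top_le_iff.1 fun x _ => ?_)
    obtain ⟨N, hN⟩ := Filter.eventually_atTop.1 D.eventually_isCompl_ker_pow_range_pow
    have hc := hN (max N (n + 1)) (le_max_left _ _)
    have hx : x ∈ LinearMap.ker (D ^ max N (n + 1)) ⊔ LinearMap.range (D ^ max N (n + 1)) :=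
      hc.sup_eq_top ▸ Submodule.mem_top
    obtain ⟨y, hy, z, ⟨w, rfl⟩, rfl⟩ := Submodule.mem_sup.1 hx
    refine add_mem (hle ((LieSubalgebra.mem_engel_iff _ _ _).2 ⟨_, hy⟩)) ?_
    obtain ⟨c, hc, he⟩ := hB w _ (le_max_right _ _)
    rw [← he]
    exact sInf_le (a := M) hM (hBΨ c hc)
  rw [Module.End.isNilpotent_iff_of_finite]
  intro x
  have hx : ((x : A) : L) ∈ LieSubalgebra.engel F ((b : A) : L) := htop ▸ LieSubalgebra.mem_top _
  obtain ⟨k, hk⟩ := (LieSubalgebra.mem_engel_iff _ _ _).1 hx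
  refine ⟨k, Subtype.ext (Subtype.ext ?_)⟩
  have : ∀ k : ℕ, ((((LieAlgebra.ad F B b ^ k) x : B) : A) : L) = (D ^ k) ((x : A) : L) := by
    intro k
    induction k with
    | zero => rfl
    | succ k ih => rw [pow_succ', pow_succ', Module.End.mul_apply, Module.End.mul_apply, ← ih]; rfl
  rw [this, hk]
  rfl

end Solvable

/-! ### Primitive algebras and Schunck classes -/

section Primitive

variable {F : Type u} [Field F] {p : ℕ} {L M : Type v} [LieRing L] [LieAlgebra F L]
  [LieRing M] [LieAlgebra F M]

/-- A surjective homomorphism to a centerless Lie algebra respects the `p`-operations. -/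
theorem LieHom.map_toFun_of_surjective {f : L →ₗ⁅F⁆ M} (hf : Function.Surjective f)
    (hM : ∀ z : M, (∀ y : M, ⁅z, y⁆ = 0) → z = 0) (P : POperation F p L) (Q : POperation F p M)
    (x : L) : f (P.toFun x) = Q.toFun (f x) := by
  have hpow : ∀ (k : ℕ) (y : L), f ((LieAlgebra.ad F L x ^ k) y) =
      (LieAlgebra.ad F M (f x) ^ k) (f y) := by
    intro k y
    induction k with
    | zero => rfl
    | succ k ih =>
      rw [pow_succ', pow_succ', Module.End.mul_apply, Module.End.mul_apply, ← ih,
        LieAlgebra.ad_apply, LieAlgebra.ad_apply, LieHom.map_lie]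
  refine sub_eq_zero.1 (hM _ fun z => ?_)
  obtain ⟨y, rfl⟩ := hf z
  rw [sub_lie, Q.toFun_lie, ← hpow, ← P.toFun_lie, LieHom.map_lie, sub_self]

namespace POperation

/-- Primitivity is invariant under isomorphism. -/
theorem IsPrimitive.of_equiv {P : POperation F p L} {Q : POperation F p M} (hQ : Q.IsPrimitive)
    (e : L ≃ₗ⁅F⁆ M) (he : ∀ x, e (P.toFun x) = Q.toFun (e x)) : P.IsPrimitive := by
  obtain ⟨hsol, S, ⟨⟨hSP, hS0⟩, hSmin⟩, hS⟩ := hQ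
  have hsurj : ∀ y, ∃ x, e x = y := e.surjective
  have hinj : ∀ x y, e x = e y → x = y := fun x y h => e.injective h
  have hcomap : ∀ K : LieIdeal F L, ∃ K' : LieIdeal F M, ∀ x, e x ∈ K' ↔ x ∈ K := fun K =>
    ⟨K.comap e.symm.toLieHom, fun x => by
      rw [LieIdeal.mem_comap]
      change e.symm (e x) ∈ K ↔ x ∈ K
      rw [e.symm_apply_apply]⟩
  have hne : ∀ (K : LieIdeal F L) (K' : LieIdeal F M), (∀ x, e x ∈ K' ↔ x ∈ K) → K ≠ ⊥ →
      K' ≠ ⊥ := by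
    rintro K K' h hK rfl
    refine hK (le_bot_iff.1 fun x hx => ?_)
    have := (h x).2 hx
    rw [LieSubmodule.mem_bot] at this
    exact hinj _ _ (this.trans (map_zero e).symm)
  let T : LieIdeal F L := S.comap e.toLieHom
  have hT : ∀ x, e x ∈ S ↔ x ∈ T := fun x => Iff.rfl
  refine ⟨(LieAlgebra.solvable_iff_equiv_solvable (R := F) e).2 hsol, T, ⟨⟨fun x hx => ?_, ?_⟩,
    fun K hK hKT => ?_⟩, fun x => ?_⟩
  · rw [← hT, he]
    exact hSP _ hx
  · intro h
    refine hS0 (le_bot_iff.1 fun y hy => ?_)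
    obtain ⟨x, rfl⟩ := hsurj y
    have : x ∈ T := hy
    rw [h, LieSubmodule.mem_bot] at this
    rw [this, map_zero]
    exact zero_mem _
  · obtain ⟨K', hK'⟩ := hcomap K
    have hle : S ≤ K' := by
      refine hSmin ⟨fun y hy => ?_, hne K K' hK' hK.2⟩ fun y hy => ?_
      · obtain ⟨x, rfl⟩ := hsurj y
        rw [← he]
        exact (hK' _).2 (hK.1 x ((hK' x).1 hy))
      · obtain ⟨x, rfl⟩ := hsurj y
        exact hKT ((hK' x).1 hy)
    exact fun x hx => (hK' x).1 (hle hx)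
  · rw [← hT, ← hS]
    constructor
    · intro h a ha
      obtain ⟨b, rfl⟩ := hsurj a
      have := h b ha
      rw [← LieEquiv.map_lie, this, map_zero]
    · intro h a ha
      refine hinj _ _ ?_
      rw [LieEquiv.map_lie, map_zero]
      exact h _ ha

/-- Properties of the minimal `[p]`-ideal of a primitive restricted Lie algebra that is not an
atom. -/
theorem IsPrimitive.exists_lieIdeal [Fact p.Prime] {P : POperation F p L} (hP : P.IsPrimitive)
    (hatom : ¬ P.IsAtomic) :
    ∃ S : LieIdeal F L, (∀ x : L, (∀ a ∈ S, ⁅x, a⁆ = 0) ↔ x ∈ S) ∧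
      (∀ I : LieIdeal F L, I ≠ ⊥ → S ≤ I) ∧ S ≠ ⊥ ∧ S ≠ ⊤ ∧
      ∀ z : L, (∀ y : L, ⁅z, y⁆ = 0) → z = 0 := by
  obtain ⟨-, S, ⟨⟨hSP, hS0⟩, hSmin⟩, hS⟩ := hP
  have hSab : ∀ s ∈ S, ∀ t ∈ S, ⁅s, t⁆ = 0 := fun s hs => (hS s).2 hs
  have hS1 : S ≠ ⊤ := by
    rintro rfl
    refine hatom ⟨?_, ?_, fun U hU => ?_⟩
    · by_contra h
      rw [not_nontrivial_iff_subsingleton] at h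
      exact hS0 (Subsingleton.elim _ _)
    · exact ⟨fun x y => hSab x (LieSubmodule.mem_top x) y (LieSubmodule.mem_top y)⟩
    · let I : LieIdeal F L :=
        { U.toSubmodule with
          lie_mem := fun {x y} _ => by
            change ⁅x, y⁆ ∈ U
            rw [hSab x (LieSubmodule.mem_top x) y (LieSubmodule.mem_top y)]
            exact U.zero_mem }
      by_cases hI : I = ⊥
      · left
        refine le_bot_iff.1 fun x hx => ?_
        have : x ∈ I := hx
        rw [hI, LieSubmodule.mem_bot] at this
        rw [this]
        exact zero_mem _
      · right
        have hUI : P.IsPIdeal I := fun x hx => hU x hx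
        exact top_le_iff.1 fun x _ => hSmin ⟨hUI, hI⟩ le_top (LieSubmodule.mem_top x)
  obtain ⟨q, hq⟩ := Nat.exists_eq_add_of_le' (Fact.out : p.Prime).two_le
  -- The centre is a `[p]`-ideal inside `C(S) = S`. If non-zero it equals `S`, and then `C(S)` is
  -- all of `L`.
  have hcen : ∀ z : L, (∀ y : L, ⁅z, y⁆ = 0) → z = 0 := by
    have hZ : LieAlgebra.center F L = ⊥ := by
      by_contra hZ
      have hmem : ∀ z ∈ LieAlgebra.center F L, ∀ y : L, ⁅z, y⁆ = 0 := fun z hz y => by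
        rw [← lie_skew, (LieModule.mem_maxTrivSubmodule F L L z).1 hz y, neg_zero]
      have hle : S ≤ LieAlgebra.center F L := by
        refine hSmin ⟨fun z hz => ?_, hZ⟩ fun z hz => (hS z).1 fun a _ => hmem z hz a
        refine (LieModule.mem_maxTrivSubmodule F L L _).2 fun y => ?_
        rw [← lie_skew, P.toFun_lie, hq, pow_succ, Module.End.mul_apply, LieAlgebra.ad_apply,
          hmem z hz, map_zero, neg_zero]
      exact hS1 (top_le_iff.1 fun x _ => (hS x).1 fun a ha =>
        (LieModule.mem_maxTrivSubmodule F L L a).1 (hle ha) x)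
    intro z hz
    have : z ∈ LieAlgebra.center F L :=
      (LieModule.mem_maxTrivSubmodule F L L z).2 fun y => by rw [← lie_skew, hz, neg_zero]
    rwa [hZ] at this
  -- `(ad s)^2 = 0` and `p ≥ 2`, so `s^[p]` is central, hence zero. Every ideal inside `S` is thus a
  -- `[p]`-ideal, which makes `S` minimal among all ideals.
  have hSp : ∀ s ∈ S, P.toFun s = 0 := fun s hs => hcen _ fun y => by
    rw [P.toFun_lie, hq, pow_add, pow_two, Module.End.mul_apply, Module.End.mul_apply,
      LieAlgebra.ad_apply, LieAlgebra.ad_apply, hSab s hs _ (lie_mem_left F L S s y hs), map_zero]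
  refine ⟨S, hS, fun I hI => ?_, hS0, hS1, hcen⟩
  have hIS : I ⊓ S ≠ ⊥ := by
    intro h
    have hlie : ∀ x ∈ I, ∀ s ∈ S, ⁅x, s⁆ = 0 := fun x hx s hs => by
      have : ⁅x, s⁆ ∈ I ⊓ S := ⟨lie_mem_left F L I x s hx, S.lie_mem hs⟩
      rwa [h] at this
    have : I ≤ S := fun x hx => (hS x).1 (hlie x hx)
    exact hI (by rwa [inf_eq_left.2 this] at h)
  refine (hSmin ⟨fun x hx => ?_, hIS⟩ inf_le_right).trans inf_le_left
  rw [hSp x hx.2]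
  exact zero_mem _

end POperation

namespace RestrictedLieAlg

/-- A primitive image of a member of a `p`-Schunck class is in the class. -/
theorem IsPSchunckClass.mem_of_surjective {ℋ : Set (RestrictedLieAlg.{u, v} F p)}
    (hℋ : IsPSchunckClass ℋ) {X Y : RestrictedLieAlg.{u, v} F p} (hX : X ∈ ℋ)
    {f : X.carrier →ₗ⁅F⁆ Y.carrier} (hf : Function.Surjective f)
    (hfp : ∀ x, f (X.op.toFun x) = Y.op.toFun (f x)) (hY0 : Y.op.toFun 0 = 0)
    (hY : Y.op.IsPrimitive) : Y ∈ ℋ := by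
  rw [← hℋ.primClosure_eq] at hX
  have hK : X.op.IsPIdeal f.ker := fun x hx => by
    rw [LieHom.mem_ker] at hx ⊢
    rw [hfp, hx, hY0]
  obtain ⟨g, hg⟩ := LieHom.exists_factor (lieQuotientMk_surjective f.ker) f
    fun x hx => LieHom.mem_ker.1 (lieQuotientMk_eq_zero.1 hx)
  have hgi : Function.Bijective g := by
    refine ⟨(injective_iff_map_eq_zero g).2 fun x hx => ?_, fun y => ?_⟩
    · obtain ⟨x, rfl⟩ := lieQuotientMk_surjective _ x
      rw [hg] at hx
      exact lieQuotientMk_eq_zero.2 (LieHom.mem_ker.2 hx)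
    · obtain ⟨x, rfl⟩ := hf y
      exact ⟨_, hg x⟩
  let e := LieEquiv.ofBijective g hgi
  have he : ∀ x, e ((X.quotient f.ker hK).op.toFun x) = Y.op.toFun (e x) := by
    intro x
    obtain ⟨x, rfl⟩ := lieQuotientMk_surjective _ x
    exact (hg _).trans ((hfp x).trans (congrArg Y.op.toFun (hg x).symm))
  exact hℋ.iso_closed _ _ (hX.2 f.ker hK (hY.of_equiv e he)) ⟨e, he⟩

end RestrictedLieAlg

end Primitive

/-! ### The theorem -/

theorem mainTheorem5 {F : Type u} [Field F] {p : ℕ} [Fact p.Prime] [CharP F p]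
    (ℋ : Set (RestrictedLieAlg.{u, v} F p)) (hℋ : RestrictedLieAlg.IsPSchunckClass ℋ)
    (hatoms : ∀ X : RestrictedLieAlg.{u, v} F p, X.op.IsAtomic → X ∈ ℋ)
    {L : Type v} [LieRing L] [LieAlgebra F L] [FiniteDimensional F L] (P : POperation F p L)
    (A : LieSubalgebra F L) (hA : P.IsPSubnormal A)
    (B : LieIdeal F A) (hB : (P.restrict A hA.isPSubalgebra).IsPIdeal B)
    (hBΨ : ∀ b : A, b ∈ B → (b : L) ∈ P.frattini)
    (hAB : RestrictedLieAlg.of ((P.restrict A hA.isPSubalgebra).quotient B hB) ∈ ℋ) :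
    RestrictedLieAlg.of (P.restrict A hA.isPSubalgebra) ∈ ℋ := by
  obtain ⟨n, C, hC0, hCn, hCi⟩ := hA.exists_chain
  have hC : IsSubidealChain A n C :=
    ⟨hC0, hCn, fun i hi => (hCi i hi).1, fun i hi => (hCi i hi).2.1⟩
  have hABsol : LieAlgebra.IsSolvable (A ⧸ B) := by
    have h := hAB
    rw [← hℋ.primClosure_eq] at h
    exact h.1
  have hBnil : LieRing.IsNilpotent B := hC.isNilpotent_of_le_frattini P B hBΨ
  have hBsol : LieAlgebra.IsSolvable B := inferInstance
  have hAsol : LieAlgebra.IsSolvable A := LieAlgebra.isSolvable_of_quotient B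
  rw [← hℋ.primClosure_eq]
  refine ⟨hAsol, fun K hK hprim => ?_⟩
  by_cases hatom : ((RestrictedLieAlg.of (P.restrict A hA.isPSubalgebra)).quotient K hK).op.IsAtomic
  · exact hatoms _ hatom
  obtain ⟨S, hS, hmin, hS0, hS1, hcen⟩ := hprim.exists_lieIdeal hatom
  -- The kernel of the new `f` contains `B` but may differ from `K`; only the isomorphism type of
  -- the image `A/K` matters.
  obtain ⟨f, hf, hfB⟩ := exists_surjective_eq_zero hS hmin hS0 hS1 _ P rfl hA.isPSubalgebra hC B
    hBΨ (lieQuotientMk K) (lieQuotientMk_surjective K)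
  obtain ⟨g, hg⟩ := LieHom.exists_factor (lieQuotientMk_surjective B) f
    fun x hx => hfB x (lieQuotientMk_eq_zero.1 hx)
  have hgs : Function.Surjective g := fun y => by
    obtain ⟨x, rfl⟩ := hf y
    exact ⟨_, hg x⟩
  refine hℋ.mem_of_surjective hAB hgs (LieHom.map_toFun_of_surjective hgs hcen _ _) ?_ hprim
  refine hcen _ fun y => ?_
  rw [POperation.toFun_lie, map_zero, zero_pow (Fact.out : p.Prime).ne_zero]
  rfl
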